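/- Let $\mathcal C$ be a braided monoidal category with braiding $c$ and unit $\mathbb 1$, and fix a universe of small sets. Suppose: (1) $\mathcal C$ has all small limits; (2) $\mathcal C$ has all finite and countable colimits; (3) $\mathcal C$ is (Epi, ExtrMono)-structured: every morphism factors as an epimorphism followed by an extremal monomorphism (a monomorphism $i$ such that $i=f\pi$ with $\pi$ an epimorphism implies that $\pi$ is an isomorphism), and every commutative square $if=g\pi$ with $\pi$ an epimorphism and $i$ an extremal monomorphism has a diagonal $t$ with $it=g$, $t\pi=f$; (4*) $\mathcal C$ is cowellpowered: for every object $M$ the equivalence classes of epimorphisms from $M$ form a small set; (5) $f\otimes\mathrm{id}_M$ and $\mathrm{id}_M\otimes f$ are monomorphisms for every monomorphism $f$ and object $M$; (5*) $f\otimes\mathrm{id}_M$ and $\mathrm{id}_M\otimes f$ are epimorphisms for every epimorphism $f$ and object $M$; (8) for every nonempty small family $(A_\alpha)_{\alpha\in\Lambda}$ and every object $M$ the canonical morphism $M\otimes\prod_\alpha A_\alpha\to\prod_\alpha (M\otimes A_\alpha)$ is a monomorphism; (10) the forgetful functor $\mathsf{Mon}(\mathcal C)\to\mathcal C$ has a left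 adjoint. Let $\Omega$ be a set with maps $s,t\colon\Omega\to\mathbb Z_{\geq 0}$ and let $A$ be an $\Omega$-magma in $\mathcal C$, i.e. an object with arbitrary morphisms $\omega_A\colon A^{\otimes s(\omega)}\to A^{\otimes t(\omega)}$, $\omega\in\Omega$, where $A^{\otimes 0}=\mathbb 1$. For a monoid $(Q,\mu,u)$ the tensor product of morphisms $\rho_i\colon A_i\to B_i\otimes Q$, $i=1,2$, is the composition $A_1\otimes A_2\to (B_1\otimes Q)\otimes(B_2\otimes Q)\to(B_1\otimes B_2)\otimes(Q\otimes Q)\to(B_1\otimes B_2)\otimes Q$ of $\rho_1\otimes\rho_2$, $\mathrm{id}_{B_1}\otimes c_{Q,B_2}\otimes\mathrm{id}_Q$ and $\mathrm{id}\otimes\mu$, and the zeroth power of such a morphism is $\mathbb 1\xrightarrow{u}Q\cong\mathbb 1\otimes Q$. A coaction of a bimonoid $B$ on $A$ is a right $B$-comodule structure $\rho\colon A\to A\otimes B$ such that $\rho^{\otimes t(\omega)}\,\omega_A=(\omega_A\otimes\mathrm{id}_B)\,\rho^{\otimes s(\omega)}$ for all $\omega\in\Omega$. A Hopf monoid is a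 bimonoid whose identity morphism is invertible under convolution. Let $\mathbf{ComodStr}(A)$, $\mathbf{Coact}(A)$ and $\mathbf{HCoact}(A)$ be the categories of, respectively, comodule structures $A\to A\otimes K$ over arbitrary comonoids $K$, coactions $A\to A\otimes B$ of arbitrary bimonoids $B$ on $A$, and coactions $A\to A\otimes H$ of arbitrary Hopf monoids $H$ on $A$; a morphism from $\rho_1\colon A\to A\otimes P_1$ to $\rho_2\colon A\to A\otimes P_2$ is a homomorphism $\varphi\colon P_1\to P_2$ of comonoids, bimonoids, resp. Hopf monoids, with $(\mathrm{id}_A\otimes\varphi)\rho_1=\rho_2$. Let $G_2\colon\mathbf{Coact}(A)\to\mathbf{ComodStr}(A)$ and $G_4\colon\mathbf{HCoact}(A)\to\mathbf{Coact}(A)$ be the forgetful functors. For a functor $G\colon Y\to X$ and an object $x_0$ of $X$, let $Y_G(x_0)$ be the full subcategory of $Y$ of all $y$ for which there is a morphism $x_0\to Gy$. Let $U$ be a comonoid in $\mathcal C$ and let $\rho_U\colon A\to A\otimes U$ be a right $U$-comodule structure on $A$ that is a tensor epimorphism: $(\mathrm{id}_A\otimes f)\rho_U=(\mathrm{id}_A\otimes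 g)\rho_U$ implies $f=g$ for all $f,g\colon U\to R$. Then $\mathbf{HCoact}(A)_{G_2G_4}(\rho_U)$ has an initial object (its Hopf monoid is called the $U$-universal coacting Hopf monoid on $A$). Moreover, $\mathbf{Coact}(A)_{G_2}(\rho_U)$ has an initial object, the forgetful functor $\mathsf{Hopf}(\mathcal C)\to\mathsf{Bimon}(\mathcal C)$ has a left adjoint, and for every such left adjoint $H_l$ with unit $\eta$ and every initial object $\rho_0\colon A\to A\otimes B_0$ of $\mathbf{Coact}(A)_{G_2}(\rho_U)$, the morphism $(\mathrm{id}_A\otimes\eta_{B_0})\rho_0\colon A\to A\otimes H_lB_0$ is an initial object of $\mathbf{HCoact}(A)_{G_2G_4}(\rho_U)$. -/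

import Mathlib

open CategoryTheory MonoidalCategory Limits
open scoped MonObj ComonObj

universe w v u v' u'

attribute [-instance] catToReflQuiver

noncomputable section

namespace UnivCoact


/-! ### Locally initial objects and the lifting problem -/

section LocallyInitial

variable {X : Type u} [Category.{v} X] {Y : Type u'} [Category.{v'} Y]

/-- An object with at most one morphism to every object. -/
def IsLocallyInitial (x₀ : X) : Prop := ∀ (x : X) (f g : x₀ ⟶ x), f = g

/-- The objects `y` of `Y` such that `G y` receives a morphism from `x₀`. -/
def liftProperty (G : Y ⥤ X) (x₀ : X) : ObjectProperty Y := fun y => Nonempty (x₀ ⟶ G.obj y)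

/-- The full subcategory `Y_G(x₀)` of `Y`. -/
abbrev LiftCat (G : Y ⥤ X) (x₀ : X) := (liftProperty G x₀).FullSubcategory

end LocallyInitial

/-! ### Conditions on the base category -/

section Conditions

variable (C : Type u) [Category.{v} C]

variable {C} in
/-- An extremal monomorphism. -/
def IsExtremalMono {A B : C} (i : A ⟶ B) : Prop :=
  Mono i ∧ ∀ ⦃Z : C⦄ (π : A ⟶ Z) (f : Z ⟶ B), Epi π → π ≫ f = i → IsIso π

/-- (Epi, ExtrMono)-structured categories. -/
structure EpiExtrMonoStructured : Prop where
  factorization : ∀ ⦃A B : C⦄ (f : A ⟶ B), ∃ (L : C) (π : A ⟶ L) (i : L ⟶ B),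
    Epi π ∧ IsExtremalMono i ∧ π ≫ i = f
  fillIn : ∀ ⦃P Q A B : C⦄ (π : P ⟶ Q) (f : P ⟶ A) (g : Q ⟶ B) (i : A ⟶ B),
    Epi π → IsExtremalMono i → f ≫ i = π ≫ g → ∃ d : Q ⟶ A, d ≫ i = g ∧ π ≫ d = f

/-- Cowellpowered categories, relative to the universe `w` of small sets: the equivalence classes
of epimorphisms from `M` (subobjects of `M` in the opposite category) form a small set. -/
def Cowellpowered : Prop := ∀ M : C, Small.{w} (Subobject (Opposite.op M))

variable [MonoidalCategory C]

/-- Tensoring with an object on either side preserves monomorphisms. -/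
def TensorPreservesMono : Prop :=
  ∀ ⦃X Y : C⦄ (f : X ⟶ Y), Mono f → ∀ M : C, Mono (f ▷ M) ∧ Mono (M ◁ f)

/-- Tensoring with an object on either side preserves epimorphisms. -/
def TensorPreservesEpi : Prop :=
  ∀ ⦃X Y : C⦄ (f : X ⟶ Y), Epi f → ∀ M : C, Epi (f ▷ M) ∧ Epi (M ◁ f)

/-- The comparison morphism `M ⊗ ∏ A_α ⟶ ∏ (M ⊗ A_α)` is a monomorphism for every nonempty small
family. -/
def TensorProdComparisonMono [HasLimitsOfSize.{w, w} C] : Prop :=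
  ∀ (Λ : Type w) [Nonempty Λ] (M : C) (A : Λ → C),
    Mono (Pi.lift (fun α => M ◁ Pi.π A α) : M ⊗ (∏ᶜ A) ⟶ ∏ᶜ fun α => M ⊗ A α)

end Conditions

/-! ### Comodules, `Ω`-magmas, comeasurings and coactions -/

section Structures

variable {C : Type u} [Category.{v} C] [MonoidalCategory C]

/-- `ρ : M ⟶ M ⊗ K` is a (right) comodule structure over the comonoid `K`. -/
structure IsComodule {K : C} [ComonObj K] {M : C} (ρ : M ⟶ M ⊗ K) : Prop where
  counit : ρ ≫ M ◁ ε[K] ≫ (ρ_ M).hom = 𝟙 M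
  coassoc : ρ ≫ M ◁ Δ[K] = ρ ≫ ρ ▷ K ≫ (α_ M K K).hom

/-- The tensor power `X^{⊗ n}`, with `X^{⊗ 0} = 𝟙` and `X^{⊗ 1} = X`. -/
def tensorPow (X : C) : ℕ → C
  | 0 => 𝟙_ C
  | 1 => X
  | n + 2 => tensorPow X (n + 1) ⊗ X

/-- An `Ω`-magma in `C`, for a signature `s t : Ω → ℕ`. -/
structure OmegaMagma (C : Type u) [Category.{v} C] [MonoidalCategory C]
    {Ω : Type u'} (s t : Ω → ℕ) where
  X : C
  op (ω : Ω) : tensorPow X (s ω) ⟶ tensorPow X (t ω)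

variable [BraidedCategory C]

/-- The monoidal product of `ρ₁` and `ρ₂` in the category `MorTens(Q)` of all morphisms
`A ⟶ B ⊗ Q` with `Q` a fixed monoid. -/
def morTensProd {Q : C} [MonObj Q] {A₁ B₁ A₂ B₂ : C} (ρ₁ : A₁ ⟶ B₁ ⊗ Q) (ρ₂ : A₂ ⟶ B₂ ⊗ Q) :
    A₁ ⊗ A₂ ⟶ (B₁ ⊗ B₂) ⊗ Q :=
  (ρ₁ ⊗ₘ ρ₂) ≫ tensorμ B₁ Q B₂ Q ≫ (B₁ ⊗ B₂) ◁ μ[Q]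

/-- The tensor powers of `ρ` in `MorTens(Q)`; the zeroth one is the monoidal unit of
`MorTens(Q)`. -/
def morTensPow {Q : C} [MonObj Q] {A B : C} (ρ : A ⟶ B ⊗ Q) :
    (n : ℕ) → (tensorPow A n ⟶ tensorPow B n ⊗ Q)
  | 0 => η[Q] ≫ (λ_ Q).inv
  | 1 => ρ
  | n + 2 => morTensProd (morTensPow ρ (n + 1)) ρ

variable {Ω : Type u'} {s t : Ω → ℕ}

/-- `ρ : A ⟶ B ⊗ Q` is a comeasuring: for each `ω` the pair `(ω_A, ω_B)` is a morphism
`ρ^{⊗ s ω} ⟶ ρ^{⊗ t ω}` in `MorTens(Q)`, so that `ρ` is an `Ω`-magma in `MorTens(Q)`. -/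
def IsComeasuring (A B : OmegaMagma C s t) {Q : C} [MonObj Q] (ρ : A.X ⟶ B.X ⊗ Q) : Prop :=
  ∀ ω : Ω, A.op ω ≫ morTensPow ρ (t ω) = morTensPow ρ (s ω) ≫ B.op ω ▷ Q

/-- `ρ` is a coaction of the bimonoid `B` on the `Ω`-magma `A`, that is, `A` with `ρ` is an
`Ω`-magma in the category of `B`-comodules. -/
structure IsCoaction (A : OmegaMagma C s t) (B : Bimon C) (ρ : A.X ⟶ A.X ⊗ B.X.X) : Prop where
  comodule : IsComodule ρ
  comeasuring : IsComeasuring A A ρ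

end Structures

/-! ### The categories of structures on a fixed object and the forgetful functors -/

section Categories

variable {C : Type u} [Category.{v} C] [MonoidalCategory C]

/-- The category of all morphisms `A ⟶ B ⊗ Q` with `A` and `B` fixed. -/
abbrev MorTens (A B : C) := StructuredArrow A (tensorLeft B)

/-- Tensor epimorphisms. -/
def IsTensorEpi {A B Q : C} (ρ : A ⟶ B ⊗ Q) : Prop :=
  IsLocallyInitial (StructuredArrow.mk (T := tensorLeft B) ρ : MorTens A B)

theorem isTensorEpi_iff {A B Q : C} (ρ : A ⟶ B ⊗ Q) :
    IsTensorEpi ρ ↔ ∀ (R : C) (f g : Q ⟶ R), ρ ≫ B ◁ f = ρ ≫ B ◁ g → f = g := by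
  constructor
  · intro h R f g hfg
    exact congrArg CommaMorphism.right (h (StructuredArrow.mk (T := tensorLeft B) (ρ ≫ B ◁ f))
      (StructuredArrow.homMk f rfl) (StructuredArrow.homMk g hfg.symm))
  · intro h x f g
    apply StructuredArrow.ext
    exact h _ _ _ ((StructuredArrow.w f).trans (StructuredArrow.w g).symm)

/-- A comodule structure `ρ : M ⟶ M ⊗ K` on `M` over some comonoid `K`. -/
structure ComodStr (M : C) where
  K : Comon C
  ρ : M ⟶ M ⊗ K.X
  isComodule : IsComodule ρ

/-- Morphisms of comodule structures are the comonoid homomorphisms compatible with them. -/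
@[ext]
structure ComodStr.Hom {M : C} (x y : ComodStr M) where
  τ : x.K ⟶ y.K
  w : x.ρ ≫ M ◁ τ.hom = y.ρ

instance (M : C) : Category (ComodStr M) where
  Hom x y := ComodStr.Hom x y
  id x := ⟨𝟙 x.K, by simp⟩
  comp f g := ⟨f.τ ≫ g.τ, by simp [reassoc_of% f.w, g.w]⟩

variable [BraidedCategory C] {Ω : Type u'} {s t : Ω → ℕ}

/-- A coaction `ρ : A ⟶ A ⊗ B` on the `Ω`-magma `A` of some bimonoid `B`. -/
structure Coact (A : OmegaMagma C s t) where
  B : Bimon C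
  ρ : A.X ⟶ A.X ⊗ B.X.X
  isCoaction : IsCoaction A B ρ

/-- Morphisms of coactions are the bimonoid homomorphisms compatible with them. -/
@[ext]
structure Coact.Hom {A : OmegaMagma C s t} (x y : Coact A) where
  φ : x.B ⟶ y.B
  w : x.ρ ≫ A.X ◁ φ.hom.hom = y.ρ

instance (A : OmegaMagma C s t) : Category (Coact A) where
  Hom x y := Coact.Hom x y
  id x := ⟨𝟙 x.B, by simp⟩
  comp f g := ⟨f.φ ≫ g.φ, by simp [reassoc_of% f.w, g.w]⟩

variable (C) in
/-- The forgetful functor from Hopf monoids to bimonoids. -/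
def hopfToBimon : Hopf C ⥤ Bimon C := inducedFunctor Hopf.toBimon

/-- A coaction `ρ : A ⟶ A ⊗ H` on the `Ω`-magma `A` of some Hopf monoid `H`. -/
structure HCoact (A : OmegaMagma C s t) where
  H : Hopf C
  ρ : A.X ⟶ A.X ⊗ ((hopfToBimon C).obj H).X.X
  isCoaction : IsCoaction A ((hopfToBimon C).obj H) ρ

/-- Morphisms of Hopf monoid coactions are the Hopf monoid homomorphisms compatible with them. -/
@[ext]
structure HCoact.Hom {A : OmegaMagma C s t} (x y : HCoact A) where
  φ : x.H ⟶ y.H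
  w : x.ρ ≫ A.X ◁ ((hopfToBimon C).map φ).hom.hom = y.ρ

instance (A : OmegaMagma C s t) : Category (HCoact A) where
  Hom x y := HCoact.Hom x y
  id x := ⟨𝟙 x.H, by simp⟩
  comp f g := ⟨f.φ ≫ g.φ, by simp [reassoc_of% f.w, g.w]⟩

/-- The forgetful functor `Coact A ⥤ ComodStr A`. -/
def G₂ (A : OmegaMagma C s t) : Coact A ⥤ ComodStr A.X where
  obj x :=
    { K := (Bimon.toComon C).obj x.B
      ρ := x.ρ
      isComodule := by
        have h := x.isCoaction.comodule
        exact ⟨(congrArg (fun e => x.ρ ≫ A.X ◁ e ≫ (ρ_ A.X).hom)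
            (Bimon.BimonObjAux_counit x.B)).trans h.counit,
          (congrArg (fun e => x.ρ ≫ A.X ◁ e) (Bimon.BimonObjAux_comul x.B)).trans h.coassoc⟩ }
  map f := ⟨(Bimon.toComon C).map f.φ, f.w⟩

/-- The forgetful functor `HCoact A ⥤ Coact A`. -/
def G₄ (A : OmegaMagma C s t) : HCoact A ⥤ Coact A where
  obj x := ⟨(hopfToBimon C).obj x.H, x.ρ, x.isCoaction⟩
  map f := ⟨(hopfToBimon C).map f.φ, f.w⟩

end Categories

end UnivCoact

end

open UnivCoact

/-! Both universal objects come from one construction, `exists_universal_mon`. Let `P` be a property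
of morphisms from a fixed object `X` to monoids, inherited by submonoids and by nonempty small
products, and satisfied at least once. Every morphism with `P` extends to the free monoid `T` on `X`
and factors through an epimorphic quotient of `T` that again has `P`. Cowellpoweredness leaves only
a small set of such quotients, and the image of `T` in their product is universal.

For coactions, `X = U` and `P` says that `ρU ≫ A.X ◁ f` is a comeasuring. Composites of comeasurings
are comeasurings, so coassociativity of `ρU` makes `Δ ≫ (j ⊗ₘ j)` admissible; the counit is
admissible too. Both extend to the universal monoid and make it a bimonoid. That `ρU` is a tensor
epimorphism is what makes morphisms out of the resulting coaction unique.

For the Hopf envelope of `B`, `X` is a countable coproduct of copies of `B` and `P` describes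
sequences that behave like `ψ, ψ ≫ S, ψ ≫ S ≫ S, …`: the zeroth term is multiplicative, and
consecutive terms are convolution inverse for successive coopposites of `B`. The braiding need not
be symmetric, so these coopposites need not repeat. Shifting the universal sequence gives the
antipode. Its axioms are not equations between monoid homomorphisms, so they are proved by showing
that their equalizer is a submonoid.

Finally, a left adjoint carries the initial bimonoid coaction to the initial Hopf coaction
(`isInitial_hcoact`). -/

namespace UnivCoact

/-! ### Convolution inverses. -/

section Convolution

variable {C : Type u} [Category.{v} C] [MonoidalCategory C]

/-- The convolution product of two morphisms from a comonoid to a monoid. -/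
def conv {M N : C} (c : ComonObj M) [MonObj N] (f g : M ⟶ N) : M ⟶ N :=
  c.comul ≫ (f ⊗ₘ g) ≫ μ[N]

/-- `f` and `g` are mutually inverse with respect to convolution. -/
structure ConvInv {M N : C} (c : ComonObj M) [MonObj N] (f g : M ⟶ N) : Prop where
  left : conv c f g = c.counit ≫ η[N]
  right : conv c g f = c.counit ≫ η[N]

theorem conv_eq_mul {M N : C} (c : ComonObj M) [MonObj N] (f g : M ⟶ N) :
    conv c f g = @HMul.hMul (Conv M N) (Conv M N) (Conv M N) _ f g := by
  change _ = Δ[M] ≫ f ▷ M ≫ N ◁ g ≫ μ[N]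
  rw [conv, MonoidalCategory.tensorHom_def, Category.assoc]

theorem conv_assoc {M N : C} (c : ComonObj M) [MonObj N] (f g h : M ⟶ N) :
    conv c (conv c f g) h = conv c f (conv c g h) := by
  rw [conv_eq_mul, conv_eq_mul, conv_eq_mul, conv_eq_mul]
  exact _root_.mul_assoc (G := Conv M N) f g h

theorem conv_one {M N : C} (c : ComonObj M) [MonObj N] (f : M ⟶ N) :
    conv c f (c.counit ≫ η[N]) = f := by
  simp only [conv_eq_mul]
  exact _root_.mul_one (M := Conv M N) f

theorem one_conv {M N : C} (c : ComonObj M) [MonObj N] (f : M ⟶ N) :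
    conv c (c.counit ≫ η[N]) f = f := by
  simp only [conv_eq_mul]
  exact _root_.one_mul (M := Conv M N) f

theorem conv_comp {M N N' : C} (c : ComonObj M) [MonObj N] [MonObj N'] (f g : M ⟶ N)
    (φ : N ⟶ N') [IsMonHom φ] : conv c f g ≫ φ = conv c (f ≫ φ) (g ≫ φ) := by
  simp [conv]

theorem comp_conv {M M' N : C} [c' : ComonObj M'] [c : ComonObj M] [MonObj N] (f g : M ⟶ N)
    (φ : M' ⟶ M) [IsComonHom φ] : φ ≫ conv c f g = conv c' (φ ≫ f) (φ ≫ g) := by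
  simp [conv]

namespace ConvInv

variable {M N : C} {c : ComonObj M} [MonObj N] {f f' g g' : M ⟶ N}

theorem symm (h : ConvInv c f g) : ConvInv c g f := ⟨h.right, h.left⟩

theorem unique (h : ConvInv c f g) (h' : ConvInv c f g') : g = g' := by
  rw [← conv_one c g, ← h'.left, ← conv_assoc, h.right, one_conv]

theorem conv (h : ConvInv c f f') (h' : ConvInv c g g') :
    ConvInv c (conv c f g) (UnivCoact.conv c g' f') := by
  constructor
  · rw [conv_assoc, ← conv_assoc c g, h'.left, one_conv, h.left]
  · rw [conv_assoc, ← conv_assoc c f', h.right, one_conv, h'.right]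

theorem comp {N' : C} [MonObj N'] (h : ConvInv c f g) (φ : N ⟶ N') [IsMonHom φ] :
    ConvInv c (f ≫ φ) (g ≫ φ) := by
  constructor
  · rw [← conv_comp, h.left]; simp
  · rw [← conv_comp, h.right]; simp

theorem precomp {M' : C} [c' : ComonObj M'] (h : ConvInv c f g) (φ : M' ⟶ M) [IsComonHom φ] :
    ConvInv c' (φ ≫ f) (φ ≫ g) := by
  constructor
  · rw [← comp_conv, h.left, ← Category.assoc, IsComonHom.hom_counit]
  · rw [← comp_conv, h.right, ← Category.assoc, IsComonHom.hom_counit]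

theorem of_jointlyMono {M Q : C} {c : ComonObj M} [MonObj Q] {g g' : M ⟶ Q} {I : Type*}
    {S : I → C} [∀ a, MonObj (S a)] (π : ∀ a, Q ⟶ S a) [∀ a, IsMonHom (π a)]
    (hπ : ∀ (p q : M ⟶ Q), (∀ a, p ≫ π a = q ≫ π a) → p = q)
    (h : ∀ a, ConvInv c (g ≫ π a) (g' ≫ π a)) : ConvInv c g g' := by
  constructor
  · refine hπ _ _ fun a => ?_
    rw [conv_comp, (h a).left]; simp
  · refine hπ _ _ fun a => ?_
    rw [conv_comp, (h a).right]; simp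

end ConvInv

end Convolution

/-! ### Coopposites, opposites, and tensor products of comonoids and of monoids. -/

section BraidedConvolution

variable {C : Type u} [Category.{v} C] [MonoidalCategory C] [BraidedCategory C]

theorem tensorμ_unit_unit (X Y : C) : tensorμ X (𝟙_ C) (𝟙_ C) Y = 𝟙 _ := by
  rw [tensorμ, braiding_tensorUnit_left]
  monoidal

theorem tensorμ_unit_left (X Y Z : C) : tensorμ (𝟙_ C) X Y Z =
    (λ_ X).hom ▷ (Y ⊗ Z) ≫ (α_ _ _ _).inv ≫ (β_ X Y).hom ▷ Z ≫ (α_ _ _ _).hom ≫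
      (λ_ Y).inv ▷ (X ⊗ Z) := by
  rw [tensorμ]
  monoidal

theorem tensorμ_unit_right (X Y Z : C) : tensorμ X Y Z (𝟙_ C) =
    (X ⊗ Y) ◁ (ρ_ Z).hom ≫ (α_ _ _ _).hom ≫ X ◁ (β_ Y Z).hom ≫ (α_ _ _ _).inv ≫
      (X ⊗ Z) ◁ (ρ_ Y).inv := by
  rw [tensorμ]
  monoidal

/-- A form of Yang–Baxter; it yields coassociativity of `cop` and associativity of `mop`. -/
theorem braiding_braiding_right (X Y Z : C) :
    (β_ (X ⊗ Y) Z).hom ≫ Z ◁ (β_ X Y).hom =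
      (α_ X Y Z).hom ≫ (β_ X (Y ⊗ Z)).hom ≫ (β_ Y Z).hom ▷ X ≫ (α_ Z Y X).hom := by
  rw [BraidedCategory.braiding_tensor_left_hom, BraidedCategory.braiding_tensor_right_hom]
  simp only [Category.assoc]
  rw [← BraidedCategory.yang_baxter]

/-- The coopposite of a comonoid. -/
@[reducible]
def cop {M : C} (c : ComonObj M) : ComonObj M where
  counit := c.counit
  comul := c.comul ≫ (β_ M M).hom
  counit_comul := by
    rw [Category.assoc, ← BraidedCategory.braiding_naturality_right, c.comul_counit_assoc]
    simp
  comul_counit := by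
    rw [Category.assoc, ← BraidedCategory.braiding_naturality_left, c.counit_comul_assoc]
    simp
  comul_assoc := by
    rw [MonoidalCategory.whiskerLeft_comp, comp_whiskerRight, Category.assoc, Category.assoc,
      Category.assoc, ← BraidedCategory.braiding_naturality_left_assoc,
      ← BraidedCategory.braiding_naturality_right_assoc, c.comul_assoc_assoc,
      ← braiding_braiding_right M M M]

/-- The opposite of a monoid. -/
@[reducible]
def mop {M : C} (m : MonObj M) : MonObj M where
  one := m.one
  mul := (β_ M M).hom ≫ m.mul
  one_mul := by
    rw [BraidedCategory.braiding_naturality_left_assoc, m.mul_one]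
    simp
  mul_one := by
    rw [BraidedCategory.braiding_naturality_right_assoc, m.one_mul]
    simp
  mul_assoc := by
    rw [MonoidalCategory.whiskerLeft_comp, comp_whiskerRight, Category.assoc, Category.assoc,
      BraidedCategory.braiding_naturality_left_assoc,
      BraidedCategory.braiding_naturality_right_assoc, m.mul_assoc,
      BraidedCategory.braiding_naturality_right_assoc,
      BraidedCategory.braiding_naturality_left_assoc,
      reassoc_of% braiding_braiding_right M M M]

section

variable {M N : C} [ComonObj M] [ComonObj N]

/-- The counits give projections of `M ⊗ N` onto its factors. Recombining them in order gives the
identity, in the reverse order the braiding (`comul_snd_fst`); this is the source of the braiding in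
antimultiplicativity. -/
theorem comul_fst_snd :
    Δ[M ⊗ N] ≫ ((M ◁ ε[N] ≫ (ρ_ M).hom) ⊗ₘ (ε[M] ▷ N ≫ (λ_ N).hom)) = 𝟙 (M ⊗ N) := by
  rw [Comon.tensorObj_comul, ← tensorHom_comp_tensorHom, ← id_tensorHom, ← tensorHom_id,
    Category.assoc, ← tensorμ_natural_assoc, tensorHom_comp_tensorHom_assoc, tensorμ_unit_unit]
  simp

theorem comul_snd_whiskerRight :
    Δ[M ⊗ N] ≫ (ε[M] ▷ N ≫ (λ_ N).hom) ▷ (M ⊗ N) =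
      M ◁ Δ[N] ≫ (α_ _ _ _).inv ≫ (β_ M N).hom ▷ N ≫ (α_ _ _ _).hom := by
  rw [Comon.tensorObj_comul, ← tensorHom_id, ← Category.comp_id (𝟙 (M ⊗ N)),
    ← tensorHom_comp_tensorHom, ← tensorHom_id, ← id_tensorHom_id,
    Category.assoc, ← tensorμ_natural_assoc, tensorHom_comp_tensorHom_assoc, tensorμ_unit_left,
    tensorHom_id, ComonObj.counit_comul, id_tensorHom_id, Category.comp_id]
  simp [MonoidalCategory.tensorHom_def']

theorem comul_whiskerLeft_fst :
    Δ[M ⊗ N] ≫ (M ⊗ N) ◁ (M ◁ ε[N] ≫ (ρ_ M).hom) =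
      Δ[M] ▷ N ≫ (α_ _ _ _).hom ≫ M ◁ (β_ M N).hom ≫ (α_ _ _ _).inv := by
  rw [Comon.tensorObj_comul, ← id_tensorHom, ← Category.comp_id (𝟙 (M ⊗ N)),
    ← tensorHom_comp_tensorHom, ← id_tensorHom, ← id_tensorHom_id,
    Category.assoc, ← tensorμ_natural_assoc, tensorHom_comp_tensorHom_assoc, tensorμ_unit_right,
    id_tensorHom N, ComonObj.comul_counit, id_tensorHom_id, Category.comp_id]
  simp [MonoidalCategory.tensorHom_def]

theorem comul_snd_fst :
    Δ[M ⊗ N] ≫ ((ε[M] ▷ N ≫ (λ_ N).hom) ⊗ₘ (M ◁ ε[N] ≫ (ρ_ M).hom)) = (β_ M N).hom := by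
  rw [MonoidalCategory.tensorHom_def, reassoc_of% comul_snd_whiskerRight (M := M) (N := N)]
  simp only [MonoidalCategory.whiskerLeft_comp, ← associator_naturality_right_assoc,
    ← whisker_exchange_assoc, ← associator_inv_naturality_right_assoc]
  rw [← MonoidalCategory.whiskerLeft_comp_assoc, ComonObj.comul_counit]
  simp

instance : IsComonHom (M ◁ ε[N] ≫ (ρ_ M).hom) where
  hom_counit := by simp [MonoidalCategory.tensorHom_def', unitors_equal]
  hom_comul := by
    rw [Comon.tensorObj_comul, ← tensorHom_comp_tensorHom, ← id_tensorHom, Category.assoc, Category.assoc,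
      ← tensorμ_natural_assoc, tensorHom_comp_tensorHom_assoc, ComonObj.counit_comul_hom,
      id_tensorHom_id, Category.comp_id, ← Category.comp_id Δ[M], ← tensorHom_comp_tensorHom,
      id_tensorHom, id_tensorHom, Category.assoc, ← tensor_right_unitality]
    simp [MonoidalCategory.tensorHom_def']

instance : IsComonHom (ε[M] ▷ N ≫ (λ_ N).hom) where
  hom_counit := by simp [MonoidalCategory.tensorHom_def]
  hom_comul := by
    rw [Comon.tensorObj_comul, ← tensorHom_comp_tensorHom, ← tensorHom_id, Category.assoc, Category.assoc,
      ← tensorμ_natural_assoc, tensorHom_comp_tensorHom_assoc, ComonObj.counit_comul_hom,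
      id_tensorHom_id, Category.comp_id, ← Category.comp_id Δ[N], ← tensorHom_comp_tensorHom,
      tensorHom_id, tensorHom_id, Category.assoc, ← tensor_left_unitality]
    simp [MonoidalCategory.tensorHom_def]

end

section

variable {M N : C} [MonObj M] [MonObj N]

theorem inl_inr_mul :
    (((ρ_ M).inv ≫ M ◁ η[N]) ⊗ₘ ((λ_ N).inv ≫ η[M] ▷ N)) ≫ μ[M ⊗ N] = 𝟙 (M ⊗ N) := by
  rw [MonObj.tensorObj.mul_def, ← tensorHom_comp_tensorHom, ← id_tensorHom, ← tensorHom_id,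
    Category.assoc, tensorμ_natural_assoc, tensorHom_comp_tensorHom, tensorμ_unit_unit]
  simp

theorem inr_inl_mul :
    (((λ_ N).inv ≫ η[M] ▷ N) ⊗ₘ ((ρ_ M).inv ≫ M ◁ η[N])) ≫ μ[M ⊗ N] = (β_ N M).hom := by
  rw [MonObj.tensorObj.mul_def, ← tensorHom_comp_tensorHom, ← id_tensorHom, ← tensorHom_id,
    Category.assoc, tensorμ_natural_assoc, tensorHom_comp_tensorHom]
  simp [tensorμ]
  monoidal

instance : IsMonHom (η[M] : 𝟙_ C ⟶ M) where
  mul_hom := by simp [unitors_equal]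

instance : IsMonHom ((ρ_ M).inv ≫ M ◁ η[N]) := inferInstance

instance : IsMonHom ((λ_ N).inv ≫ η[M] ▷ N) := inferInstance
end

end BraidedConvolution

/-! ### Antipode sequences. -/

section AntipodeSequences

variable {C : Type u} [Category.{v} C] [MonoidalCategory C] [BraidedCategory C]

section

variable {M N R : C} [cM : ComonObj M] [cN : ComonObj N] [MonObj R]

theorem conv_fst_snd (a : M ⟶ R) (b : N ⟶ R) :
    conv (inferInstanceAs (ComonObj (M ⊗ N))) ((M ◁ ε[N] ≫ (ρ_ M).hom) ≫ a)
      ((ε[M] ▷ N ≫ (λ_ N).hom) ≫ b) = (a ⊗ₘ b) ≫ μ[R] := by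
  rw [conv, ← tensorHom_comp_tensorHom, Category.assoc]
  exact (reassoc_of% comul_fst_snd (M := M) (N := N)) _

theorem conv_snd_fst (a : M ⟶ R) (b : N ⟶ R) :
    conv (inferInstanceAs (ComonObj (M ⊗ N))) ((ε[M] ▷ N ≫ (λ_ N).hom) ≫ b)
      ((M ◁ ε[N] ≫ (ρ_ M).hom) ≫ a) = (β_ M N).hom ≫ (b ⊗ₘ a) ≫ μ[R] := by
  rw [conv, ← tensorHom_comp_tensorHom, Category.assoc]
  exact (reassoc_of% comul_snd_fst (M := M) (N := N)) _

end

section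

variable {M M' N' : C} [MonObj M'] [MonObj N'] (c : ComonObj M) (a : M ⟶ M') (b : M ⟶ N')

theorem conv_inl_inr :
    conv c (a ≫ (ρ_ M').inv ≫ M' ◁ η[N']) (b ≫ (λ_ N').inv ≫ η[M'] ▷ N') =
      c.comul ≫ (a ⊗ₘ b) := by
  rw [conv, ← tensorHom_comp_tensorHom, Category.assoc, inl_inr_mul, Category.comp_id]

theorem conv_inr_inl :
    conv c (b ≫ (λ_ N').inv ≫ η[M'] ▷ N') (a ≫ (ρ_ M').inv ≫ M' ◁ η[N']) =
      (cop c).comul ≫ (a ⊗ₘ b) := by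
  rw [conv, ← tensorHom_comp_tensorHom, Category.assoc, inr_inl_mul,
    BraidedCategory.braiding_naturality]
  exact (Category.assoc _ _ _).symm

end

instance {B : C} [BimonObj B] : IsComonHom μ[B] where
  hom_counit := by simp
  hom_comul := by simp

instance {B : C} [BimonObj B] : IsMonHom Δ[B] where
  mul_hom := by simp [MonObj.tensorObj.mul_def]

instance {B : C} [BimonObj B] : IsMonHom ε[B] where
  mul_hom := by simp

namespace ConvInv

variable {B R : C} [BimonObj B] [m : MonObj R] {f f' : B ⟶ R}

theorem one_comp [IsMonHom f] (h : ConvInv inferInstance f f') : η[B] ≫ f' = η[R] := by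
  have := congrArg (fun x => η[B] ≫ x) h.left
  simp only [UnivCoact.conv, Bimon.one_comul_assoc, tensorHom_comp_tensorHom_assoc,
    IsMonHom.one_hom] at this
  rw [MonoidalCategory.tensorHom_def'] at this
  simpa using this

/-- Both sides are convolution inverse to `μ[B] ≫ f`. For the right-hand side, write `μ[B] ≫ f` as
the product of `f` on the two projections; inverting a product reverses its factors. -/
theorem mul_comp [IsMonHom f] (h : ConvInv inferInstance f f') :
    μ[B] ≫ f' = (β_ B B).hom ≫ (f' ⊗ₘ f') ≫ μ[R] := by
  have h₁ := h.precomp μ[B]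
  have h₂ := (h.precomp (B ◁ ε[B] ≫ (ρ_ B).hom)).conv (h.precomp (ε[B] ▷ B ≫ (λ_ B).hom))
  rw [conv_snd_fst f' f', conv_fst_snd f f, ← IsMonHom.mul_hom] at h₂
  exact h₁.unique h₂

/-- Dual to `mul_comp`: `c.comul ≫ (g ⊗ₘ g)` is the product of the copies of `g` in the two factors
of `R ⊗ R`, and reversing that product replaces `c` by `cop c`. -/
theorem comul {M : C} {c : ComonObj M} {g g' : M ⟶ R} (h : ConvInv c g g') :
    ConvInv c (c.comul ≫ (g ⊗ₘ g)) ((cop c).comul ≫ (g' ⊗ₘ g')) := by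
  rw [← conv_inl_inr, ← conv_inr_inl]
  exact (h.comp _).conv (h.comp _)

/-- Naturality moves the braiding from the comultiplication to the multiplication, exchanging the
factors; hence the two inverse laws trade places. -/
theorem of_cop {M : C} {c : ComonObj M} {g g' : M ⟶ R} (h : ConvInv (cop c) g g') :
    @ConvInv _ _ _ _ _ c (mop m) g g' := by
  refine @ConvInv.mk _ _ _ _ _ _ (mop m) _ _ ?_ ?_
  · refine Eq.trans ?_ h.right
    change c.comul ≫ (g ⊗ₘ g') ≫ (β_ R R).hom ≫ m.mul =
      (c.comul ≫ (β_ M M).hom) ≫ (g' ⊗ₘ g) ≫ m.mul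
    rw [BraidedCategory.braiding_naturality_assoc, Category.assoc]
  · refine Eq.trans ?_ h.left
    change c.comul ≫ (g' ⊗ₘ g) ≫ (β_ R R).hom ≫ m.mul =
      (c.comul ≫ (β_ M M).hom) ≫ (g ⊗ₘ g') ≫ m.mul
    rw [BraidedCategory.braiding_naturality_assoc, Category.assoc]

end ConvInv

/-- The comonoid obtained from `c` by taking the coopposite `n` times. -/
@[reducible]
def copIter {M : C} (c : ComonObj M) : ℕ → ComonObj M
  | 0 => c
  | n + 1 => cop (copIter c n)

theorem copIter_counit {M : C} (c : ComonObj M) (n : ℕ) : (copIter c n).counit = c.counit := by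
  induction n with
  | zero => rfl
  | succ n ih => exact ih

/-- Sequences of morphisms behaving like the composites of a bimonoid homomorphism to a Hopf monoid
with the powers of the antipode. -/
structure IsAntipodeSeq {B R : C} [BimonObj B] [MonObj R] (f : ℕ → (B ⟶ R)) : Prop where
  isMonHom : IsMonHom (f 0)
  convInv (n : ℕ) : ConvInv (copIter inferInstance n) (f n) (f (n + 1))

namespace IsAntipodeSeq

variable {B R : C} [BimonObj B] [m : MonObj R] {f : ℕ → (B ⟶ R)}

/-- Supplies both closure conditions of `exists_universal_mon`: a single monomorphism, or the
projections of a product. -/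
theorem of_jointlyMono {I : Type*} {S : I → C} [∀ a, MonObj (S a)] (π : ∀ a, R ⟶ S a)
    [∀ a, IsMonHom (π a)]
    (hπ : ∀ {Z : C} (p q : Z ⟶ R), (∀ a, p ≫ π a = q ≫ π a) → p = q)
    (h : ∀ a, IsAntipodeSeq (fun n => f n ≫ π a)) : IsAntipodeSeq f where
  isMonHom :=
    { one_hom := hπ _ _ fun a => by
        have := (h a).isMonHom.one_hom
        simpa using this
      mul_hom := hπ _ _ fun a => by
        have := (h a).isMonHom.mul_hom
        simpa using this }
  convInv n := .of_jointlyMono π (fun _ _ => hπ _ _) fun a => (h a).convInv n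

theorem comul (h : IsAntipodeSeq f) :
    IsAntipodeSeq (fun n => (copIter (inferInstanceAs (ComonObj B)) n).comul ≫ (f n ⊗ₘ f n)) where
  isMonHom :=
    have := h.isMonHom
    inferInstanceAs (IsMonHom (Δ[B] ≫ (f 0 ⊗ₘ f 0)))
  convInv n := (h.convInv n).comul

theorem counit : IsAntipodeSeq (fun _ => ε[B]) where
  isMonHom := inferInstance
  convInv n := by
    have : conv (copIter inferInstance n) ε[B] ε[B] =
        (copIter (inferInstanceAs (ComonObj B)) n).counit ≫ η[𝟙_ C] := by
      rw [conv, ← copIter_counit _ n, (copIter _ n).counit_comul_hom_assoc]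
      simp
    exact ⟨this, this⟩

/-- `f 1` is antimultiplicative, being inverse to a homomorphism, and `of_cop` absorbs one
coopposite into the opposite of `R`. Lifting this shifted sequence produces the antipode. -/
theorem shift (h : IsAntipodeSeq f) :
    @IsAntipodeSeq _ _ _ _ _ _ _ (mop m) (fun n => f (n + 1)) :=
  have := h.isMonHom
  @IsAntipodeSeq.mk _ _ _ _ _ _ _ (mop m) _
    (@IsMonHom.mk _ _ _ _ _ _ (mop m) _ (h.convInv 0).one_comp
      ((h.convInv 0).mul_comp.trans (BraidedCategory.braiding_naturality_assoc _ _ _).symm))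
    fun n => (h.convInv (n + 1)).of_cop

end IsAntipodeSeq

/-- The composites of a morphism to a Hopf monoid with the powers of the antipode. -/
def antipodeSeq {B K : C} [HopfObj K] (ψ : B ⟶ K) : ℕ → (B ⟶ K)
  | 0 => ψ
  | n + 1 => antipodeSeq ψ n ≫ HopfObj.antipode

section

variable {B K : C} [BimonObj B] [HopfObj K] (ψ : B ⟶ K) [IsBimonHom ψ]

theorem antipodeSeq_counit (n : ℕ) : antipodeSeq ψ n ≫ ε[K] = ε[B] := by
  induction n with
  | zero => exact IsComonHom.hom_counit ψ
  | succ n ih => rw [antipodeSeq, Category.assoc, HopfObj.antipode_counit, ih]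

/-- Each antipode reverses the comultiplication and so contributes one more braiding, matching one
more `cop`. -/
theorem antipodeSeq_comul (n : ℕ) : antipodeSeq ψ n ≫ Δ[K] =
    (copIter (inferInstanceAs (ComonObj B)) n).comul ≫ (antipodeSeq ψ n ⊗ₘ antipodeSeq ψ n) := by
  induction n with
  | zero => exact IsComonHom.hom_comul ψ
  | succ n ih =>
    rw [antipodeSeq, Category.assoc, HopfObj.antipode_comul, reassoc_of% ih,
      BraidedCategory.braiding_naturality_assoc, tensorHom_comp_tensorHom]
    exact (Category.assoc _ _ _).symm

theorem isAntipodeSeq_antipodeSeq : IsAntipodeSeq (antipodeSeq ψ) where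
  isMonHom := inferInstanceAs (IsMonHom ψ)
  convInv n := by
    have h : ∀ p q : K ⟶ K, conv (copIter inferInstance n) (antipodeSeq ψ n ≫ p)
        (antipodeSeq ψ n ≫ q) = antipodeSeq ψ n ≫ conv inferInstance p q := fun p q => by
      rw [conv, conv, ← tensorHom_comp_tensorHom, Category.assoc, ← reassoc_of% antipodeSeq_comul]
    constructor
    · have := h (𝟙 K) HopfObj.antipode
      rw [Category.comp_id] at this
      refine this.trans ?_
      rw [conv, id_tensorHom, HopfObj.antipode_right, reassoc_of% antipodeSeq_counit ψ n,
        copIter_counit]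
    · have := h HopfObj.antipode (𝟙 K)
      rw [Category.comp_id] at this
      refine this.trans ?_
      rw [conv, tensorHom_id, HopfObj.antipode_left, reassoc_of% antipodeSeq_counit ψ n,
        copIter_counit]

end

end AntipodeSequences

/-! ### Universal monoids under a fixed object. -/

section InitialMonoid

variable {C : Type u} [Category.{v} C] [MonoidalCategory C]

theorem TensorPreservesEpi.tensorHom (h : TensorPreservesEpi C) {X Y X' Y' : C} (f : X ⟶ Y)
    (g : X' ⟶ Y') [Epi f] [Epi g] : Epi (f ⊗ₘ g) := by
  rw [MonoidalCategory.tensorHom_def]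
  have := (h f inferInstance X').1
  have := (h g inferInstance Y).2
  exact epi_comp _ _

theorem isMonHom_of_epi_comp (h : TensorPreservesEpi C) {T L R : C} [MonObj T] [MonObj L]
    [MonObj R] (π : T ⟶ L) (e : L ⟶ R) [Epi π] [IsMonHom π] [IsMonHom (π ≫ e)] : IsMonHom e where
  one_hom := by rw [← IsMonHom.one_hom π, Category.assoc, IsMonHom.one_hom]
  mul_hom := by
    have := h.tensorHom π π
    rw [← cancel_epi (π ⊗ₘ π), ← IsMonHom.mul_hom_assoc, IsMonHom.mul_hom,
      tensorHom_comp_tensorHom_assoc]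

/-- The monoid structure on a subobject closed under unit and multiplication. -/
@[reducible]
def monObjOfMono {K R : C} [MonObj R] (i : K ⟶ R) [Mono i] (one : 𝟙_ C ⟶ K) (mul : K ⊗ K ⟶ K)
    (h₁ : one ≫ i = η[R]) (h₂ : mul ≫ i = (i ⊗ₘ i) ≫ μ[R]) : MonObj K where
  one := one
  mul := mul
  one_mul := by
    rw [← cancel_mono i, Category.assoc, h₂, ← tensorHom_id, tensorHom_comp_tensorHom_assoc, h₁,
      Category.id_comp, MonObj.one_mul_hom]
  mul_one := by
    rw [← cancel_mono i, Category.assoc, h₂, ← id_tensorHom, tensorHom_comp_tensorHom_assoc, h₁,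
      Category.id_comp, MonObj.mul_one_hom]
  mul_assoc := by
    rw [← cancel_mono i]
    simp only [Category.assoc, h₂]
    rw [← tensorHom_id, tensorHom_comp_tensorHom_assoc, h₂, ← id_tensorHom,
      tensorHom_comp_tensorHom_assoc, h₂, Category.id_comp, ← Category.comp_id i,
      ← tensorHom_comp_tensorHom_assoc, tensorHom_id, Category.comp_id, MonObj.mul_assoc,
      associator_naturality_assoc, ← id_tensorHom, tensorHom_comp_tensorHom_assoc,
      Category.comp_id]

/-- Since `π ⊗ₘ π` is still an epimorphism, the diagonal fill-in defines a multiplication on the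
image. -/
theorem exists_mon_factorization (h3 : EpiExtrMonoStructured C) (h5' : TensorPreservesEpi C)
    {T R : Mon C} (t : T ⟶ R) :
    ∃ (L : Mon C) (π : T ⟶ L) (i : L ⟶ R), Epi π.hom ∧ Mono i.hom ∧ π ≫ i = t := by
  obtain ⟨L, π, i, hπ, hi, hf⟩ := h3.factorization t.hom
  have := h5'.tensorHom π π
  obtain ⟨d, hd, hd'⟩ := h3.fillIn (π ⊗ₘ π) (μ[T.X] ≫ π) ((i ⊗ₘ i) ≫ μ[R.X]) i this hi (by
    rw [Category.assoc, hf, tensorHom_comp_tensorHom_assoc, hf, IsMonHom.mul_hom])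
  have := hi.1
  let _ := monObjOfMono i (η[T.X] ≫ π) d (by rw [Category.assoc, hf, IsMonHom.one_hom]) hd
  have hπm : IsMonHom π := ⟨rfl, hd'.symm⟩
  have him : IsMonHom i := ⟨by change (_ ≫ _) ≫ _ = _; rw [Category.assoc, hf, IsMonHom.one_hom], hd⟩
  exact ⟨⟨L⟩, ⟨π⟩, ⟨i⟩, hπ, hi.1, Mon.Hom.ext' hf⟩

/-- A solution-set argument with quotients of the free monoid on `X` as the solution set. -/
theorem exists_universal_mon [HasLimitsOfSize.{w, w} C] (h3 : EpiExtrMonoStructured C)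
    (h4' : Cowellpowered.{w} C) (h5' : TensorPreservesEpi C) (h10 : (Mon.forget C).IsRightAdjoint)
    (X : C) (P : ∀ R : Mon C, (X ⟶ R.X) → Prop)
    (hmono : ∀ {L R : Mon C} (i : L ⟶ R) (f : X ⟶ L.X), Mono i.hom → P R (f ≫ i.hom) → P L f)
    (hprod : ∀ (Λ : Type w) [Nonempty Λ] (R : Λ → Mon C) (Q : Mon C) (π : ∀ a, Q ⟶ R a)
      (_ : IsLimit (Fan.mk Q.X fun a => (π a).hom)) (f : X ⟶ Q.X),
      (∀ a, P (R a) (f ≫ (π a).hom)) → P Q f)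
    (hne : ∃ (R : Mon C) (f : X ⟶ R.X), P R f) :
    ∃ (Q : Mon C) (j : X ⟶ Q.X), P Q j ∧
      (∀ (R : Mon C) (f : X ⟶ R.X), P R f → ∃ g : Q ⟶ R, j ≫ g.hom = f) ∧
      ∀ (R : Mon C) (g g' : Q ⟶ R), j ≫ g.hom = j ≫ g'.hom → g = g' := by
  obtain ⟨F, ⟨adj⟩⟩ := h10.exists_leftAdjoint
  let T := F.obj X
  let e : X ⟶ T.X := adj.unit.app X
  have hT : ∀ {R : Mon C} (f : X ⟶ R.X), ∃ t : T ⟶ R, e ≫ t.hom = f := fun {R} f =>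
    ⟨(adj.homEquiv X R).symm f, by
      have := (adj.homEquiv X R).apply_symm_apply f
      rwa [adj.homEquiv_unit] at this⟩
  have hT' : ∀ {R : Mon C} (t t' : T ⟶ R), e ≫ t.hom = e ≫ t'.hom → t = t' := fun {R} t t' h => by
    apply (adj.homEquiv X R).injective
    rw [adj.homEquiv_unit, adj.homEquiv_unit]
    exact h
  -- Quotients of `T` with property `P`, up to equivalence; `h4'` makes this index type small.
  let I := {s : Subobject (Opposite.op T.X) // ∃ (L : Mon C) (π : T ⟶ L) (_ : Epi π.hom),
    Subobject.mk π.hom.op = s ∧ P L (e ≫ π.hom)}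
  have := h4' T.X
  choose L π hπ hs hP using fun s : I => s.2
  have key : ∀ (R : Mon C) (f : X ⟶ R.X), P R f →
      ∃ (s : I) (g : L s ⟶ R), e ≫ (π s).hom ≫ g.hom = f := by
    intro R f hf
    obtain ⟨t, ht⟩ := hT f
    obtain ⟨L', π', i, hπ', hi, hfac⟩ := exists_mon_factorization h3 h5' t
    have hfac' : π'.hom ≫ i.hom = t.hom := congrArg Mon.Hom.hom hfac
    have hP' : P L' (e ≫ π'.hom) := hmono i _ hi (by rwa [Category.assoc, hfac', ht])
    let s : I := ⟨Subobject.mk π'.hom.op, L', π', hπ', rfl, hP'⟩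
    have hs' : Subobject.mk (π s).hom.op = Subobject.mk π'.hom.op := hs s
    let q : (L s).X ⟶ L'.X := (Subobject.ofMkLEMk _ _ hs'.ge).unop
    have hq : (π s).hom ≫ q = π'.hom :=
      congrArg Quiver.Hom.unop (Subobject.ofMkLEMk_comp (f := π'.hom.op) (g := (π s).hom.op) hs'.ge)
    have := hπ s
    have : IsMonHom ((π s).hom ≫ q) := by rw [hq]; infer_instance
    have := isMonHom_of_epi_comp h5' (π s).hom q
    exact ⟨s, Mon.Hom.mk q ≫ i, by
      rw [Mon.comp_hom', reassoc_of% hq, hfac', ht]⟩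
  obtain ⟨R₀, f₀, hf₀⟩ := hne
  -- Needed because `hprod` only covers nonempty families.
  have : Nonempty (Shrink.{w} I) := ⟨equivShrink I (key R₀ f₀ hf₀).choose⟩
  let L₀ : Shrink.{w} I → Mon C := fun a => L ((equivShrink I).symm a)
  -- The image is taken instead of the whole product so that `T ⟶ Q` is an epimorphism, which gives
  -- uniqueness.
  obtain ⟨Q, p, i, hp, hi, hfac⟩ := exists_mon_factorization h3 h5'
    (Pi.lift (fun a : Shrink.{w} I => π ((equivShrink I).symm a)) : T ⟶ ∏ᶜ L₀)
  have hfac' : ∀ a, p.hom ≫ i.hom ≫ (Pi.π L₀ a).hom = (π ((equivShrink I).symm a)).hom := by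
    intro a
    have := congrArg (fun x => (x ≫ Pi.π L₀ a).hom) hfac
    simpa using this
  refine ⟨Q, e ≫ p.hom, ?_, ?_, ?_⟩
  · refine hmono i _ hi (hprod (Shrink.{w} I) L₀ (∏ᶜ L₀) (Pi.π L₀)
      (isLimitFanMkObjOfIsLimit (Mon.forget C) _ _ (productIsProduct L₀)) _ fun a => ?_)
    rw [Category.assoc, Category.assoc, hfac']
    exact hP _
  · intro R f hf
    obtain ⟨s, g, hg⟩ := key R f hf
    obtain ⟨a, rfl⟩ := (equivShrink I).symm.surjective s
    refine ⟨i ≫ Pi.π L₀ a ≫ g, ?_⟩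
    have := hfac' a
    simp only [Mon.comp_hom', Category.assoc] at this ⊢
    rw [reassoc_of% this, hg]
  · intro R g g' h
    have : p ≫ g = p ≫ g' := hT' _ _ (by simpa using h)
    apply Mon.Hom.ext'
    rw [← cancel_epi p.hom]
    exact congrArg Mon.Hom.hom this

end InitialMonoid

/-! ### Stability of the antipode identities under multiplication. -/

section HopfEnvelope

variable {C : Type u} [Category.{v} C] [MonoidalCategory C] [BraidedCategory C]

section Antipode

/-- Pulls `u ▷ N` to the front, so that `u` may be replaced by any morphism agreeing with it after
precomposition. -/
theorem conv_snd_whiskerRight {M M' N R : C} [ComonObj M] [ComonObj N] [MonObj R] (u : M ⟶ M')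
    (m : M' ⊗ N ⟶ R) (a : N ⟶ R) :
    conv inferInstance ((ε[M] ▷ N ≫ (λ_ N).hom) ≫ a) (u ▷ N ≫ m) =
      u ▷ N ≫ M' ◁ Δ[N] ≫ (α_ _ _ _).inv ≫ (β_ M' N).hom ▷ N ≫ (α_ _ _ _).hom ≫
        (a ⊗ₘ m) ≫ μ[R] := by
  have : ((ε[M] ▷ N ≫ (λ_ N).hom) ≫ a) ⊗ₘ (u ▷ N ≫ m) =
      (ε[M] ▷ N ≫ (λ_ N).hom) ▷ (M ⊗ N) ≫ N ◁ u ▷ N ≫ (a ⊗ₘ m) := by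
    rw [MonoidalCategory.whiskerLeft_comp_tensorHom, MonoidalCategory.whiskerRight_comp_tensorHom]
  rw [conv, this]
  simp only [Category.assoc]
  rw [reassoc_of% comul_snd_whiskerRight (M := M) (N := N)]
  rw [← associator_naturality_middle_assoc, ← comp_whiskerRight_assoc,
    ← BraidedCategory.braiding_naturality_left, comp_whiskerRight_assoc,
    ← associator_inv_naturality_left_assoc, whisker_exchange_assoc]

theorem conv_whiskerLeft_fst {M N N' R : C} [ComonObj M] [ComonObj N] [MonObj R] (u : N ⟶ N')
    (m : M ⊗ N' ⟶ R) (a : M ⟶ R) :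
    conv inferInstance (M ◁ u ≫ m) ((M ◁ ε[N] ≫ (ρ_ M).hom) ≫ a) =
      M ◁ u ≫ Δ[M] ▷ N' ≫ (α_ _ _ _).hom ≫ M ◁ (β_ M N').hom ≫ (α_ _ _ _).inv ≫
        (m ⊗ₘ a) ≫ μ[R] := by
  have : (M ◁ u ≫ m) ⊗ₘ ((M ◁ ε[N] ≫ (ρ_ M).hom) ≫ a) =
      (M ⊗ N) ◁ (M ◁ ε[N] ≫ (ρ_ M).hom) ≫ (M ◁ u) ▷ M ≫ (m ⊗ₘ a) := by
    rw [MonoidalCategory.whiskerRight_comp_tensorHom, MonoidalCategory.whiskerLeft_comp_tensorHom]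
  rw [conv, this]
  simp only [Category.assoc]
  rw [reassoc_of% comul_whiskerLeft_fst (M := M) (N := N)]
  rw [← associator_inv_naturality_middle_assoc, ← MonoidalCategory.whiskerLeft_comp_assoc,
    ← BraidedCategory.braiding_naturality_right, MonoidalCategory.whiskerLeft_comp_assoc,
    ← associator_naturality_right_assoc, ← whisker_exchange_assoc]

variable {H K : C} [BimonObj H] {S : H ⟶ H} (k : K ⟶ H)

/-- In elements and up to braidings, `S(xy)₁(xy)₂` becomes `S(y₁) (S(x₁) x₂) y₂`. Using `hk` on the
inner bracket leaves `S(y₁) y₂`, to which `hk` applies again. -/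
theorem conv_antipode_left_mul (hS : μ[H] ≫ S = (β_ H H).hom ≫ (S ⊗ₘ S) ≫ μ[H])
    (hk : k ≫ conv inferInstance S (𝟙 H) = k ≫ ε[H] ≫ η[H]) :
    ((k ⊗ₘ k) ≫ μ[H]) ≫ conv inferInstance S (𝟙 H) = ((k ⊗ₘ k) ≫ μ[H]) ≫ ε[H] ≫ η[H] := by
  have h₁ : ∀ u : H ⟶ H, u ▷ H ≫ μ[H] = conv (inferInstanceAs (ComonObj (H ⊗ H)))
      ((H ◁ ε[H] ≫ (ρ_ H).hom) ≫ u) ((ε[H] ▷ H ≫ (λ_ H).hom) ≫ 𝟙 H) := fun u => by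
    rw [conv_fst_snd, tensorHom_id]
  have h₂ : μ[H] ≫ conv inferInstance S (𝟙 H) =
      conv inferInstance ((ε[H] ▷ H ≫ (λ_ H).hom) ≫ S)
        (conv inferInstance S (𝟙 H) ▷ H ≫ μ[H]) := by
    have h := h₁ (𝟙 H)
    rw [id_whiskerRight, Category.id_comp] at h
    rw [h₁, comp_conv, comp_conv, hS, ← conv_snd_fst, conv_assoc, conv_assoc, Category.comp_id μ[H],
      ← h]
  have h₃ : (ε[H] ≫ η[H]) ▷ H ≫ μ[H] = ε[H] ▷ H ≫ (λ_ H).hom := by simp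
  have h₄ : (k ⊗ₘ k) ≫ conv inferInstance S (𝟙 H) ▷ H = (k ⊗ₘ k) ≫ (ε[H] ≫ η[H]) ▷ H := by
    rw [tensorHom_comp_whiskerRight, tensorHom_comp_whiskerRight, hk]
  rw [Category.assoc, h₂, conv_snd_whiskerRight, reassoc_of% h₄, ← conv_snd_whiskerRight, h₃]
  nth_rw 2 [← Category.comp_id (ε[H] ▷ H ≫ (λ_ H).hom)]
  rw [← comp_conv]
  have : (k ⊗ₘ k) ≫ ε[H] ▷ H ≫ (λ_ H).hom = (k ≫ ε[H]) ▷ K ≫ (λ_ K).hom ≫ k := by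
    rw [MonoidalCategory.tensorHom_def]
    simp [whisker_exchange_assoc]
  rw [← Category.assoc, this]
  simp only [Category.assoc, hk]
  simp [MonoidalCategory.tensorHom_def, whisker_exchange_assoc]

theorem conv_antipode_right_mul (hS : μ[H] ≫ S = (β_ H H).hom ≫ (S ⊗ₘ S) ≫ μ[H])
    (hk : k ≫ conv inferInstance (𝟙 H) S = k ≫ ε[H] ≫ η[H]) :
    ((k ⊗ₘ k) ≫ μ[H]) ≫ conv inferInstance (𝟙 H) S = ((k ⊗ₘ k) ≫ μ[H]) ≫ ε[H] ≫ η[H] := by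
  have h₁ : ∀ u : H ⟶ H, H ◁ u ≫ μ[H] = conv (inferInstanceAs (ComonObj (H ⊗ H)))
      ((H ◁ ε[H] ≫ (ρ_ H).hom) ≫ 𝟙 H) ((ε[H] ▷ H ≫ (λ_ H).hom) ≫ u) := fun u => by
    rw [conv_fst_snd, id_tensorHom]
  have h₂ : μ[H] ≫ conv inferInstance (𝟙 H) S =
      conv inferInstance (H ◁ conv inferInstance (𝟙 H) S ≫ μ[H])
        ((H ◁ ε[H] ≫ (ρ_ H).hom) ≫ S) := by
    have h := h₁ (𝟙 H)
    rw [MonoidalCategory.whiskerLeft_id, Category.id_comp] at h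
    rw [h₁, comp_conv, comp_conv, hS, ← conv_snd_fst, ← conv_assoc, ← conv_assoc,
      Category.comp_id μ[H], ← h]
  have h₃ : H ◁ (ε[H] ≫ η[H]) ≫ μ[H] = H ◁ ε[H] ≫ (ρ_ H).hom := by simp
  have h₄ : (k ⊗ₘ k) ≫ H ◁ conv inferInstance (𝟙 H) S = (k ⊗ₘ k) ≫ H ◁ (ε[H] ≫ η[H]) := by
    rw [tensorHom_comp_whiskerLeft, tensorHom_comp_whiskerLeft, hk]
  rw [Category.assoc, h₂, conv_whiskerLeft_fst, reassoc_of% h₄, ← conv_whiskerLeft_fst, h₃]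
  nth_rw 1 [← Category.comp_id (H ◁ ε[H] ≫ (ρ_ H).hom)]
  rw [← comp_conv]
  have : (k ⊗ₘ k) ≫ H ◁ ε[H] ≫ (ρ_ H).hom = K ◁ (k ≫ ε[H]) ≫ (ρ_ K).hom ≫ k := by
    rw [MonoidalCategory.tensorHom_def']
    simp [← whisker_exchange_assoc]
  rw [← Category.assoc, this]
  simp only [Category.assoc, hk]
  simp [MonoidalCategory.tensorHom_def', unitors_equal, ← whisker_exchange_assoc]

end Antipode

end HopfEnvelope

/-! ### The Hopf envelope of a bimonoid. -/

section HopfEnvelope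

variable {C : Type u} [Category.{v} C] [MonoidalCategory C] [BraidedCategory C]

/-- A bimonoid structure on a monoid generated by a family of comonoids. -/
@[reducible]
def bimonObjOfFamily {I : Type*} {X : I → C} {H : C} [MonObj H] (c : ∀ i, ComonObj (X i))
    (j : ∀ i, X i ⟶ H)
    (hom_ext : ∀ {R : C} [MonObj R] (g g' : H ⟶ R) [IsMonHom g] [IsMonHom g'],
      (∀ i, j i ≫ g = j i ≫ g') → g = g')
    (comul : H ⟶ H ⊗ H) (counit : H ⟶ 𝟙_ C) [IsMonHom comul] [IsMonHom counit]
    (h₁ : ∀ i, j i ≫ comul = (c i).comul ≫ (j i ⊗ₘ j i)) (h₂ : ∀ i, j i ≫ counit = (c i).counit) :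
    BimonObj H where
  comul := comul
  counit := counit
  -- The comonoid axioms compare monoid homomorphisms, so they can be tested on generators, where
  -- they are those of `c i`.
  counit_comul := hom_ext _ _ fun i => by
    rw [reassoc_of% h₁, tensorHom_comp_whiskerRight, h₂, (c i).counit_comul_hom,
      leftUnitor_inv_naturality]
  comul_counit := hom_ext _ _ fun i => by
    rw [reassoc_of% h₁, tensorHom_comp_whiskerLeft, h₂, (c i).comul_counit_hom,
      rightUnitor_inv_naturality]
  comul_assoc := hom_ext _ _ fun i => by
    rw [reassoc_of% h₁, tensorHom_comp_whiskerLeft, reassoc_of% h₁,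
      tensorHom_comp_whiskerRight_assoc, h₁, ← whiskerLeft_comp_tensorHom,
      (c i).comul_assoc_assoc, ← whiskerRight_comp_tensorHom_assoc, associator_naturality]
  mul_comul := by
    rw [IsMonHom.mul_hom, MonObj.tensorObj.mul_def]
  one_comul := IsMonHom.one_hom _
  mul_counit := by
    rw [IsMonHom.mul_hom]
    rfl
  one_counit := IsMonHom.one_hom _

/-- Antipode sequences through which all the others factor uniquely. -/
structure IsUniversalAntipodeSeq {B H : C} [BimonObj B] [MonObj H] (j : ℕ → (B ⟶ H)) : Prop where
  isAntipodeSeq : IsAntipodeSeq j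
  exists_lift {R : C} [MonObj R] (f : ℕ → (B ⟶ R)) (hf : IsAntipodeSeq f) :
    ∃ g : H ⟶ R, IsMonHom g ∧ ∀ n, j n ≫ g = f n
  hom_ext {R : C} [MonObj R] (g g' : H ⟶ R) [IsMonHom g] [IsMonHom g']
    (h : ∀ n, j n ≫ g = j n ≫ g') : g = g'

/-- The countable coproduct encodes a sequence as one morphism; the constant sequence `ε[B]` shows
that the property is satisfied. -/
theorem exists_isUniversalAntipodeSeq [HasLimitsOfSize.{w, w} C] [HasCountableColimits C]
    (h3 : EpiExtrMonoStructured C) (h4' : Cowellpowered.{w} C) (h5' : TensorPreservesEpi C)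
    (h10 : (Mon.forget C).IsRightAdjoint) (B : C) [BimonObj B] :
    ∃ (H : Mon C) (j : ℕ → (B ⟶ H.X)), IsUniversalAntipodeSeq j := by
  obtain ⟨H, j, hj, hlift, hext⟩ := exists_universal_mon h3 h4' h5' h10 (∐ fun _ : ℕ => B)
    (fun R f => IsAntipodeSeq (R := R.X) fun n => Sigma.ι (fun _ : ℕ => B) n ≫ f)
    (fun {L R} i f hi h => .of_jointlyMono (fun _ : Unit => i.hom)
      (fun p q hpq => (cancel_mono i.hom).1 (hpq ())) fun _ => by simpa using h)
    (fun Λ _ R Q π hQ f h => .of_jointlyMono (fun a => (π a).hom)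
      (fun p q hpq => Fan.IsLimit.hom_ext hQ p q hpq) fun a => by simpa using h a)
    ⟨⟨𝟙_ C⟩, Sigma.desc fun _ => ε[B], by simpa using IsAntipodeSeq.counit⟩
  refine ⟨H, fun n => Sigma.ι (fun _ : ℕ => B) n ≫ j, hj, ?_, ?_⟩
  · intro R _ f hf
    obtain ⟨g, hg⟩ := hlift ⟨R⟩ (Sigma.desc f) (by simpa using hf)
    exact ⟨g.hom, inferInstance, fun n => by simp [hg]⟩
  · intro R _ g g' _ _ h
    refine congrArg Mon.Hom.hom (hext ⟨R⟩ ⟨g⟩ ⟨g'⟩ (Sigma.hom_ext _ _ fun n => ?_))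
    simpa using h n

namespace IsUniversalAntipodeSeq

variable {B H : C} [BimonObj B] [MonObj H] {j : ℕ → (B ⟶ H)}

/-- Needed because `u` and `v` need not be multiplicative. Their equalizer is a submonoid through
which the sequence `j` factors; universality then splits the inclusion, so the equalizer is all of
`H`. -/
theorem eq_of_mul_closed [HasEqualizers C] (hj : IsUniversalAntipodeSeq j) {Y : C} (u v : H ⟶ Y)
    (hone : η[H] ≫ u = η[H] ≫ v)
    (hmul : ∀ {K : C} (k : K ⟶ H), k ≫ u = k ≫ v → ((k ⊗ₘ k) ≫ μ[H]) ≫ u = ((k ⊗ₘ k) ≫ μ[H]) ≫ v)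
    (h : ∀ n, j n ≫ u = j n ≫ v) : u = v := by
  let k := equalizer.ι u v
  have hk : k ≫ u = k ≫ v := equalizer.condition u v
  let _ := monObjOfMono k (equalizer.lift η[H] hone) (equalizer.lift _ (hmul k hk))
    (equalizer.lift_ι _ _) (equalizer.lift_ι _ _)
  have : IsMonHom k := ⟨equalizer.lift_ι _ _, equalizer.lift_ι _ _⟩
  have hl : ∀ n, equalizer.lift (j n) (h n) ≫ k = j n := fun n => equalizer.lift_ι _ _
  obtain ⟨g, _, hg⟩ := hj.exists_lift (fun n => equalizer.lift (j n) (h n))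
    (.of_jointlyMono (fun _ : Unit => k) (fun p q hpq => (cancel_mono k).1 (hpq ()))
      fun _ => by simpa only [hl] using hj.isAntipodeSeq)
  have : g ≫ k = 𝟙 H := hj.hom_ext _ _ fun n => by rw [reassoc_of% hg n, hl, Category.comp_id]
  rw [← Category.id_comp u, ← Category.id_comp v, ← this, Category.assoc, Category.assoc, hk]

theorem exists_comul (hj : IsUniversalAntipodeSeq j) : ∃ g : H ⟶ H ⊗ H, IsMonHom g ∧
    ∀ n, j n ≫ g = (copIter (inferInstanceAs (ComonObj B)) n).comul ≫ (j n ⊗ₘ j n) :=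
  hj.exists_lift _ hj.isAntipodeSeq.comul

theorem exists_counit (hj : IsUniversalAntipodeSeq j) :
    ∃ g : H ⟶ 𝟙_ C, IsMonHom g ∧ ∀ n, j n ≫ g = ε[B] :=
  hj.exists_lift _ .counit

/-- The bimonoid structure on the target of a universal antipode sequence. -/
@[reducible]
noncomputable def bimonObj (hj : IsUniversalAntipodeSeq j) : BimonObj H :=
  have := hj.exists_comul.choose_spec.1
  have := hj.exists_counit.choose_spec.1
  bimonObjOfFamily (copIter inferInstance) j hj.hom_ext hj.exists_comul.choose
    hj.exists_counit.choose hj.exists_comul.choose_spec.2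
    fun n => (hj.exists_counit.choose_spec.2 n).trans (copIter_counit _ n).symm

theorem exists_antipode (hj : IsUniversalAntipodeSeq j) : ∃ S : H ⟶ H,
    η[H] ≫ S = η[H] ∧ μ[H] ≫ S = (β_ H H).hom ≫ (S ⊗ₘ S) ≫ μ[H] ∧ ∀ n, j n ≫ S = j (n + 1) := by
  obtain ⟨S, hS, hS'⟩ := @exists_lift _ _ _ _ _ _ _ _ _ hj H (mop inferInstance) _ hj.isAntipodeSeq.shift
  refine ⟨S, @hS.one_hom, (@hS.mul_hom).trans ?_, hS'⟩
  exact BraidedCategory.braiding_naturality_assoc _ _ _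

/-- The Hopf monoid structure on the target of a universal antipode sequence. -/
@[reducible]
noncomputable def hopfObj [HasEqualizers C] (hj : IsUniversalAntipodeSeq j) : HopfObj H :=
  let b := hj.bimonObj
  have h₁ : ∀ n, j n ≫ b.comul = (copIter (inferInstanceAs (ComonObj B)) n).comul ≫ (j n ⊗ₘ j n) :=
    hj.exists_comul.choose_spec.2
  have h₂ : ∀ n, j n ≫ b.counit = ε[B] := hj.exists_counit.choose_spec.2
  have hS := hj.exists_antipode.choose_spec.1
  have hS' := hj.exists_antipode.choose_spec.2.1
  have hS'' := hj.exists_antipode.choose_spec.2.2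
  { b with
    antipode := hj.exists_antipode.choose
    antipode_left := by
      rw [← tensorHom_id]
      refine hj.eq_of_mul_closed _ _ ?_ (fun k hk => conv_antipode_left_mul k hS' hk) fun n => ?_
      · rw [Bimon.one_comul_assoc, tensorHom_comp_tensorHom_assoc, hS, BimonObj.one_counit_assoc,
          Category.comp_id, MonObj.one_mul_hom, Iso.inv_hom_id_assoc]
      -- On the `n`-th generator the antipode becomes `j (n + 1)`, and the identity is one of the
      -- two inverse laws for `j n`.
      · rw [reassoc_of% h₁, tensorHom_comp_tensorHom_assoc, hS'', Category.comp_id,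
          reassoc_of% h₂, ← copIter_counit _ n]
        exact (hj.isAntipodeSeq.convInv n).right
    antipode_right := by
      rw [← id_tensorHom]
      refine hj.eq_of_mul_closed _ _ ?_ (fun k hk => conv_antipode_right_mul k hS' hk) fun n => ?_
      · rw [Bimon.one_comul_assoc, tensorHom_comp_tensorHom_assoc, hS, BimonObj.one_counit_assoc,
          Category.comp_id, MonObj.one_mul_hom, Iso.inv_hom_id_assoc]
      · rw [reassoc_of% h₁, tensorHom_comp_tensorHom_assoc, hS'', Category.comp_id,
          reassoc_of% h₂, ← copIter_counit _ n]
        exact (hj.isAntipodeSeq.convInv n).left }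

theorem isBimonHom_zero (hj : IsUniversalAntipodeSeq j) :
    let _ := hj.bimonObj
    IsBimonHom (j 0) := by
  intro b
  have := hj.isAntipodeSeq.isMonHom
  have : IsComonHom (j 0) := ⟨hj.exists_counit.choose_spec.2 0, hj.exists_comul.choose_spec.2 0⟩
  exact {}

/-- Existence lifts the sequence of `ψ` followed by powers of the antipode of `K`. Uniqueness is by
induction: `j (n + 1) ≫ g` is the convolution inverse of `j n ≫ g`, so `j 0 ≫ g` determines all of
them. -/
theorem existsUnique_isBimonHom (hj : IsUniversalAntipodeSeq j) {K : C} [HopfObj K] (ψ : B ⟶ K)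
    [IsBimonHom ψ] :
    let _ := hj.bimonObj
    (∃ g : H ⟶ K, IsBimonHom g ∧ j 0 ≫ g = ψ) ∧
      ∀ g g' : H ⟶ K, IsBimonHom g → IsBimonHom g' → j 0 ≫ g = j 0 ≫ g' → g = g' := by
  intro b
  have h₁ : ∀ n, j n ≫ b.comul = (copIter (inferInstanceAs (ComonObj B)) n).comul ≫ (j n ⊗ₘ j n) :=
    hj.exists_comul.choose_spec.2
  have h₂ : ∀ n, j n ≫ b.counit = ε[B] := hj.exists_counit.choose_spec.2
  constructor
  · obtain ⟨g, hg, hg'⟩ := hj.exists_lift _ (isAntipodeSeq_antipodeSeq ψ)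
    have : IsComonHom g := by
      constructor
      · exact hj.hom_ext _ _ fun n => by rw [reassoc_of% hg', antipodeSeq_counit, h₂]
      · exact hj.hom_ext _ _ fun n => by
          rw [reassoc_of% hg', antipodeSeq_comul, reassoc_of% h₁, tensorHom_comp_tensorHom, hg']
    exact ⟨g, {}, hg' 0⟩
  · intro g g' _ _ h
    refine hj.hom_ext _ _ fun n => ?_
    induction n with
    | zero => exact h
    | succ n ih =>
      have h₁ := (hj.isAntipodeSeq.convInv n).comp g
      rw [ih] at h₁
      exact h₁.unique ((hj.isAntipodeSeq.convInv n).comp g')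

end IsUniversalAntipodeSeq

/-- Bimonoid homomorphisms as morphisms in the category of bimonoids. -/
def bimonHomMk {X Y : Bimon C} (f : X.X.X ⟶ Y.X.X) [IsBimonHom f] : X ⟶ Y :=
  Comon.Hom.mk' (Mon.Hom.mk f : X.X ⟶ Y.X)
    (Mon.Hom.ext' (IsComonHom.hom_counit f)) (Mon.Hom.ext' (IsComonHom.hom_comul f))

theorem isBimonHom_hom_hom {X Y : Bimon C} (f : X ⟶ Y) : IsBimonHom f.hom.hom :=
  have : IsComonHom f.hom.hom :=
    ⟨congrArg Mon.Hom.hom f.isComonHom_hom.hom_counit,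
      congrArg Mon.Hom.hom f.isComonHom_hom.hom_comul⟩
  {}

/-- Hopf monoid homomorphisms are the bimonoid homomorphisms. -/
def hopfToBimonFullyFaithful : (hopfToBimon C).FullyFaithful :=
  fullyFaithfulInducedFunctor Hopf.toBimon

theorem hopfToBimon_isRightAdjoint [HasLimitsOfSize.{w, w} C] [HasCountableColimits C]
    (h3 : EpiExtrMonoStructured C) (h4' : Cowellpowered.{w} C) (h5' : TensorPreservesEpi C)
    (h10 : (Mon.forget C).IsRightAdjoint) : (hopfToBimon C).IsRightAdjoint := by
  have : HasFiniteLimits C := hasFiniteLimits_of_hasLimitsOfSize.{w, w} C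
  have (B : Bimon C) : HasInitial (StructuredArrow B (hopfToBimon C)) := by
    obtain ⟨H, j, hj⟩ := exists_isUniversalAntipodeSeq h3 h4' h5' h10 B.X.X
    let _ := hj.hopfObj
    have := hj.isBimonHom_zero
    let h : B ⟶ (hopfToBimon C).obj ⟨H.X⟩ :=
      @bimonHomMk _ _ _ _ B ((hopfToBimon C).obj ⟨H.X⟩) (j 0) this
    have hex (y : StructuredArrow B (hopfToBimon C)) :
        ∃ g : (hopfToBimon C).obj ⟨H.X⟩ ⟶ (hopfToBimon C).obj y.right, h ≫ g = y.hom := by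
      have := isBimonHom_hom_hom y.hom
      obtain ⟨g, hg, hg'⟩ := (@IsUniversalAntipodeSeq.existsUnique_isBimonHom _ _ _ _ _ _ _ _ _ hj
        y.right.X _ y.hom.hom.hom this).1
      exact ⟨@bimonHomMk _ _ _ _ ((hopfToBimon C).obj ⟨H.X⟩) ((hopfToBimon C).obj y.right) g hg,
        Bimon.ext hg'⟩
    have huniq (y : Hopf C) (g g' : (hopfToBimon C).obj ⟨H.X⟩ ⟶ (hopfToBimon C).obj y)
        (hg : h ≫ g = h ≫ g') : g = g' :=
      Bimon.ext ((@IsUniversalAntipodeSeq.existsUnique_isBimonHom _ _ _ _ _ _ _ _ _ hj y.X _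
          (h ≫ g).hom.hom (isBimonHom_hom_hom _)).2 g.hom.hom g'.hom.hom (isBimonHom_hom_hom g)
        (isBimonHom_hom_hom g') (congrArg (fun x => x.hom.hom) hg))
    choose g hg using hex
    exact (IsInitial.ofUniqueHom (X := StructuredArrow.mk h)
      (fun y => StructuredArrow.homMk (hopfToBimonFullyFaithful.preimage (g y))
        (by simpa using hg y))
      fun y m => StructuredArrow.ext _ _ (hopfToBimonFullyFaithful.map_injective
        (huniq _ _ _ (by simpa [hg] using StructuredArrow.w m)))).hasInitial
  exact isRightAdjointOfStructuredArrowInitials _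

end HopfEnvelope

/-! ### Tensor powers and composites of comeasurings. -/

section Comeasurings

variable {C : Type u} [Category.{v} C] [MonoidalCategory C] [BraidedCategory C]

theorem morTensProd_map {Q R : C} [MonObj Q] [MonObj R] {A₁ B₁ A₂ B₂ : C} (ρ₁ : A₁ ⟶ B₁ ⊗ Q)
    (ρ₂ : A₂ ⟶ B₂ ⊗ Q) (φ : Q ⟶ R) [IsMonHom φ] :
    morTensProd (ρ₁ ≫ B₁ ◁ φ) (ρ₂ ≫ B₂ ◁ φ) = morTensProd ρ₁ ρ₂ ≫ (B₁ ⊗ B₂) ◁ φ := by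
  have h : (B₁ ◁ φ ⊗ₘ B₂ ◁ φ) ≫ tensorμ B₁ R B₂ R = tensorμ B₁ Q B₂ Q ≫ (B₁ ⊗ B₂) ◁ (φ ⊗ₘ φ) := by
    rw [← id_tensorHom, ← id_tensorHom, tensorμ_natural, id_tensorHom_id, id_tensorHom]
  simp only [morTensProd, Category.assoc, ← MonoidalCategory.whiskerLeft_comp, IsMonHom.mul_hom]
  rw [← tensorHom_comp_tensorHom, Category.assoc, reassoc_of% h, MonoidalCategory.whiskerLeft_comp]

theorem morTensPow_map {Q R : C} [MonObj Q] [MonObj R] {A B : C} (ρ : A ⟶ B ⊗ Q) (φ : Q ⟶ R)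
    [IsMonHom φ] : ∀ n : ℕ, morTensPow (ρ ≫ B ◁ φ) n = morTensPow ρ n ≫ tensorPow B n ◁ φ
  | 0 => by
    simp only [morTensPow, tensorPow, Category.assoc]
    rw [← leftUnitor_inv_naturality, IsMonHom.one_hom_assoc]
  | 1 => rfl
  | n + 2 => by
    rw [morTensPow, morTensPow_map ρ φ (n + 1), morTensProd_map]
    rfl

/-- The composite of two morphisms with coefficients. -/
def morTensComp {X Y Z Q R : C} (ρ : X ⟶ Y ⊗ Q) (σ : Y ⟶ Z ⊗ R) : X ⟶ Z ⊗ R ⊗ Q :=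
  ρ ≫ σ ▷ Q ≫ (α_ Z R Q).hom

/-- Interchange of tensoring with composition, where coefficients multiply in `R ⊗ Q`; the braidings
match by `associator_monoidal`. -/
theorem morTensProd_morTensComp {Q R : C} [MonObj Q] [MonObj R] {X₁ Y₁ Z₁ X₂ Y₂ Z₂ : C}
    (ρ₁ : X₁ ⟶ Y₁ ⊗ Q) (σ₁ : Y₁ ⟶ Z₁ ⊗ R) (ρ₂ : X₂ ⟶ Y₂ ⊗ Q) (σ₂ : Y₂ ⟶ Z₂ ⊗ R) :
    morTensProd (morTensComp ρ₁ σ₁) (morTensComp ρ₂ σ₂) =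
      morTensComp (morTensProd ρ₁ ρ₂) (morTensProd σ₁ σ₂) := by
  have h₁ : (σ₁ ▷ Q ⊗ₘ σ₂ ▷ Q) ≫ tensorμ (Z₁ ⊗ R) Q (Z₂ ⊗ R) Q =
      tensorμ Y₁ Q Y₂ Q ≫ (σ₁ ⊗ₘ σ₂) ▷ (Q ⊗ Q) := by
    rw [← tensorHom_id, ← tensorHom_id, tensorμ_natural, id_tensorHom_id, tensorHom_id]
  simp only [morTensProd, morTensComp, MonObj.tensorObj.mul_def, MonoidalCategory.whiskerLeft_comp,
    ← tensorHom_comp_tensorHom, Category.assoc]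
  rw [← associator_monoidal_assoc, reassoc_of% h₁]
  simp only [comp_whiskerRight, Category.assoc]
  rw [whisker_exchange_assoc, whisker_exchange_assoc, whisker_exchange_assoc,
    MonoidalCategory.tensorHom_def μ[R], MonoidalCategory.whiskerLeft_comp,
    ← associator_naturality_middle_assoc, ← associator_naturality_right]

theorem morTensPow_morTensComp {Q R : C} [MonObj Q] [MonObj R] {X Y Z : C}
    (ρ : X ⟶ Y ⊗ Q) (σ : Y ⟶ Z ⊗ R) :
    ∀ n : ℕ, morTensPow (morTensComp ρ σ) n = morTensComp (morTensPow ρ n) (morTensPow σ n)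
  | 0 => by
    simp only [morTensPow, tensorPow, morTensComp, MonObj.tensorObj.one_def]
    rw [MonoidalCategory.tensorHom_def', Category.assoc, Category.assoc,
      ← leftUnitor_inv_naturality_assoc]
    simp
  | 1 => rfl
  | n + 2 => by
    rw [morTensPow, morTensPow_morTensComp ρ σ (n + 1), morTensProd_morTensComp]
    rfl

theorem morTensPow_rightUnitor_inv (A : C) :
    ∀ n : ℕ, morTensPow (ρ_ A).inv n = (ρ_ (tensorPow A n)).inv
  | 0 => by
    simp [morTensPow, tensorPow, unitors_inv_equal]
  | 1 => rfl
  | n + 2 => by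
    rw [morTensPow, morTensPow_rightUnitor_inv A (n + 1), morTensProd]
    change _ = (ρ_ (tensorPow A (n + 1) ⊗ A)).inv
    rw [← cancel_mono (ρ_ (tensorPow A (n + 1) ⊗ A)).hom, Category.assoc, Category.assoc,
      show μ[𝟙_ C] = (λ_ (𝟙_ C)).hom from rfl, ← rightUnitor_monoidal, tensorHom_comp_tensorHom]
    simp

variable {Ω : Type u'} {s t : Ω → ℕ} {A B D : OmegaMagma C s t} {Q R : C} [MonObj Q] [MonObj R]

namespace IsComeasuring

theorem map {ρ : A.X ⟶ B.X ⊗ Q} (h : IsComeasuring A B ρ) (φ : Q ⟶ R) [IsMonHom φ] :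
    IsComeasuring A B (ρ ≫ B.X ◁ φ) := fun ω => by
  rw [morTensPow_map, morTensPow_map, reassoc_of% h ω, Category.assoc, whisker_exchange]

/-- The comeasuring equation lives in `M ⊗ Q`, so the `π a` must stay jointly monic after tensoring
with `M`. For submonoids this is tensor-stability of monomorphisms, for products the comparison
condition. -/
theorem of_jointlyMono {ρ : A.X ⟶ B.X ⊗ Q} {I : Type*} {S : I → C} [∀ a, MonObj (S a)]
    (π : ∀ a, Q ⟶ S a) [∀ a, IsMonHom (π a)]
    (hπ : ∀ {M Z : C} (p q : Z ⟶ M ⊗ Q), (∀ a, p ≫ M ◁ π a = q ≫ M ◁ π a) → p = q)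
    (h : ∀ a, IsComeasuring A B (ρ ≫ B.X ◁ π a)) : IsComeasuring A B ρ := fun ω =>
  hπ _ _ fun a => by
    have := h a ω
    rwa [morTensPow_map, morTensPow_map, Category.assoc, whisker_exchange, ← Category.assoc,
      ← Category.assoc] at this

theorem morTensComp {ρ : A.X ⟶ B.X ⊗ Q} {σ : B.X ⟶ D.X ⊗ R} (h : IsComeasuring A B ρ)
    (h' : IsComeasuring B D σ) : IsComeasuring A D (morTensComp ρ σ) := fun ω => by
  rw [morTensPow_morTensComp, morTensPow_morTensComp, UnivCoact.morTensComp, reassoc_of% h ω,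
    ← comp_whiskerRight_assoc, h' ω]
  simp [UnivCoact.morTensComp]

theorem rightUnitor_inv : IsComeasuring A A (ρ_ A.X).inv := fun ω => by
  rw [morTensPow_rightUnitor_inv, morTensPow_rightUnitor_inv, rightUnitor_inv_naturality]

end IsComeasuring

end Comeasurings

/-! ### Initial coactions of bimonoids and of Hopf monoids. -/

section Coactions

variable {C : Type u} [Category.{v} C] [MonoidalCategory C]

namespace IsComodule

variable {K L M : C} [ComonObj K] [ComonObj L] {ρ : M ⟶ M ⊗ K}

theorem comp_counit (h : IsComodule ρ) : ρ ≫ M ◁ ε[K] = (ρ_ M).inv := by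
  rw [← cancel_mono (ρ_ M).hom, Category.assoc, h.counit, Iso.inv_hom_id]

theorem map (h : IsComodule ρ) (φ : K ⟶ L) [IsComonHom φ] : IsComodule (ρ ≫ M ◁ φ) where
  counit := by
    rw [Category.assoc, ← MonoidalCategory.whiskerLeft_comp_assoc, IsComonHom.hom_counit, h.counit]
  coassoc := by
    rw [Category.assoc, ← MonoidalCategory.whiskerLeft_comp, IsComonHom.hom_comul,
      MonoidalCategory.whiskerLeft_comp, reassoc_of% h.coassoc, MonoidalCategory.tensorHom_def']
    simp [whisker_exchange_assoc]

end IsComodule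

theorem TensorProdComparisonMono.hom_ext [HasLimitsOfSize.{w, w} C]
    (h8 : TensorProdComparisonMono.{w} C) {Λ : Type w} [Nonempty Λ] {A : Λ → C} {Q : C}
    {π : ∀ a, Q ⟶ A a} (hQ : IsLimit (Fan.mk Q π)) {M Z : C} (p q : Z ⟶ M ⊗ Q)
    (h : ∀ a, p ≫ M ◁ π a = q ≫ M ◁ π a) : p = q := by
  have := h8 Λ M A
  let e : Q ≅ ∏ᶜ A := hQ.conePointUniqueUpToIso (productIsProduct A)
  have he : ∀ a, e.hom ≫ Pi.π A a = π a := fun a =>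
    hQ.conePointUniqueUpToIso_hom_comp (productIsProduct A) ⟨a⟩
  rw [← cancel_mono (M ◁ e.hom), ← cancel_mono (Pi.lift (fun α => M ◁ Pi.π A α))]
  refine Pi.hom_ext _ _ fun a => ?_
  simpa [← MonoidalCategory.whiskerLeft_comp, he] using h a

variable [BraidedCategory C] {Ω : Type u'} {s t : Ω → ℕ} {A : OmegaMagma C s t}

/-- Comonoid homomorphisms to a bimonoid as morphisms in the category of comonoids. -/
def comonHomMk {K : Comon C} {B : Bimon C} (f : K.X ⟶ B.X.X) [IsComonHom f] :
    K ⟶ (Bimon.toComon C).obj B :=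
  Comon.Hom.mk' f ((congrArg (fun e => f ≫ e) (Bimon.BimonObjAux_counit B)).trans
      (IsComonHom.hom_counit f))
    ((congrArg (fun e => f ≫ e) (Bimon.BimonObjAux_comul B)).trans (IsComonHom.hom_comul f))

theorem isComonHom_hom_toComon {K : Comon C} {B : Bimon C} (τ : K ⟶ (Bimon.toComon C).obj B) :
    IsComonHom (N := B.X.X) τ.hom :=
  ⟨(congrArg (fun e => τ.hom ≫ e) (Bimon.BimonObjAux_counit B).symm).trans
      (IsComonHom.hom_counit τ.hom),
    (congrArg (fun e => τ.hom ≫ e) (Bimon.BimonObjAux_comul B).symm).trans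
      (IsComonHom.hom_comul τ.hom)⟩

theorem IsCoaction.map {B B' : Bimon C} {ρ : A.X ⟶ A.X ⊗ B.X.X} (h : IsCoaction A B ρ)
    (φ : B ⟶ B') : IsCoaction A B' (ρ ≫ A.X ◁ φ.hom.hom) :=
  have := isBimonHom_hom_hom φ
  ⟨h.comodule.map _, h.comeasuring.map _⟩

variable {U : Comon C} {ρU : A.X ⟶ A.X ⊗ U.X}

/-- Coassociativity of `ρU` identifies this morphism with the composite of `ρU ≫ A.X ◁ j` with
itself. -/
theorem isComeasuring_comul (hU : IsComodule ρU) {Q : C} [MonObj Q] {j : U.X ⟶ Q}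
    (h : IsComeasuring A A (ρU ≫ A.X ◁ j)) :
    IsComeasuring A A (ρU ≫ A.X ◁ (Δ[U.X] ≫ (j ⊗ₘ j))) := by
  have := h.morTensComp h
  convert this using 1
  rw [MonoidalCategory.whiskerLeft_comp, reassoc_of% hU.coassoc, UnivCoact.morTensComp,
    MonoidalCategory.tensorHom_def']
  simp [whisker_exchange_assoc]

theorem hasInitial_coact_liftCat [HasLimitsOfSize.{w, w} C]
    (h3 : EpiExtrMonoStructured C) (h4' : Cowellpowered.{w} C) (h5 : TensorPreservesMono C)
    (h5' : TensorPreservesEpi C) (h8 : TensorProdComparisonMono.{w} C)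
    (h10 : (Mon.forget C).IsRightAdjoint) (hU : IsComodule ρU) (hepi : IsTensorEpi ρU) :
    HasInitial (LiftCat (G₂ A) ⟨U, ρU, hU⟩) := by
  obtain ⟨Q, j, hj, hlift, hext⟩ := exists_universal_mon h3 h4' h5' h10 U.X
    (fun R f => IsComeasuring A A (ρU ≫ A.X ◁ f))
    (fun {L R} i f hi h => .of_jointlyMono (fun _ : Unit => i.hom)
      (fun {M Z} p q hpq => have := (h5 i.hom hi M).2; (cancel_mono (M ◁ i.hom)).1 (hpq ()))
      fun _ => by simpa using h)
    (fun Λ _ R Q π hQ f h => .of_jointlyMono (fun a => (π a).hom)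
      (fun {M Z} p q hpq => h8.hom_ext hQ p q hpq) fun a => by simpa using h a)
    ⟨⟨𝟙_ C⟩, ε[U.X], by
      rw [hU.comp_counit]; exact .rightUnitor_inv⟩
  obtain ⟨δ, hδ⟩ := hlift ⟨Q.X ⊗ Q.X⟩ _ (isComeasuring_comul hU hj)
  obtain ⟨e, he⟩ := hlift ⟨𝟙_ C⟩ ε[U.X] (by rw [hU.comp_counit]; exact .rightUnitor_inv)
  have hext' {R : C} [MonObj R] (g g' : Q.X ⟶ R) [IsMonHom g] [IsMonHom g']
      (h : j ≫ g = j ≫ g') : g = g' :=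
    congrArg Mon.Hom.hom (hext ⟨R⟩ ⟨g⟩ ⟨g'⟩ h)
  have := δ.isMonHom_hom
  have := e.isMonHom_hom
  let _ : BimonObj Q.X := bimonObjOfFamily (I := Unit) (fun _ => inferInstance) (fun _ => j)
    (fun g g' _ _ h => hext' g g' (h ())) δ.hom e.hom (fun _ => hδ) (fun _ => he)
  have hjc : IsComonHom j := ⟨he, hδ⟩
  let B : Bimon C := .mk' Q.X
  let x : Coact A := ⟨B, ρU ≫ A.X ◁ j, ⟨hU.map j, hj⟩⟩
  have hx : liftProperty (G₂ A) ⟨U, ρU, hU⟩ x := ⟨⟨@comonHomMk _ _ _ _ U B j hjc, rfl⟩⟩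
  have hex (y : Coact A) (hy : liftProperty (G₂ A) ⟨U, ρU, hU⟩ y) : Nonempty (x ⟶ y) := by
    obtain ⟨τ, hτ⟩ := hy
    obtain ⟨f, hfc, hf⟩ : ∃ f : U.X ⟶ y.B.X.X, IsComonHom f ∧ ρU ≫ A.X ◁ f = y.ρ :=
      ⟨τ.hom, isComonHom_hom_toComon τ, hτ⟩
    obtain ⟨g, hgm, hg⟩ : ∃ g : Q.X ⟶ y.B.X.X, IsMonHom g ∧ j ≫ g = f := by
      obtain ⟨g, hg⟩ := hlift y.B.X f (by rw [hf]; exact y.isCoaction.comeasuring)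
      exact ⟨g.hom, g.isMonHom_hom, hg⟩
    -- Both sides of each equation are monoid homomorphisms out of `Q`, so comparing them after `j`
    -- suffices; there `j` and `f` are comonoid homomorphisms.
    have hgc : IsComonHom g := by
      constructor
      · exact hext' _ _ (by rw [reassoc_of% hg, IsComonHom.hom_counit, IsComonHom.hom_counit])
      · refine hext' _ _ ?_
        rw [reassoc_of% hg, IsComonHom.hom_comul, IsComonHom.hom_comul_assoc,
          tensorHom_comp_tensorHom, hg]
    have hgb : IsBimonHom g := {}
    refine ⟨⟨@bimonHomMk _ _ _ _ B y.B g hgb, ?_⟩⟩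
    change (ρU ≫ A.X ◁ j) ≫ A.X ◁ g = y.ρ
    rw [Category.assoc, ← MonoidalCategory.whiskerLeft_comp, hg, hf]
  have huniq (y : Coact A) (f g : x ⟶ y) : f = g := by
    refine Coact.Hom.ext (Bimon.ext (congrArg Mon.Hom.hom (hext _ f.φ.hom g.φ.hom ?_)))
    -- Compatibility with the coactions only compares the maps after `ρU`; the tensor epimorphism
    -- property cancels it.
    refine (isTensorEpi_iff ρU).1 hepi _ _ _ ?_
    rw [MonoidalCategory.whiskerLeft_comp, MonoidalCategory.whiskerLeft_comp, ← Category.assoc,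
      ← Category.assoc]
    exact f.w.trans g.w.symm
  exact (IsInitial.ofUniqueHom (X := (⟨x, hx⟩ : LiftCat (G₂ A) ⟨U, ρU, hU⟩))
    (fun y => ObjectProperty.homMk (hex y.obj y.property).some)
    fun y m => ObjectProperty.hom_ext _ (huniq _ _ _)).hasInitial

/-- A Hopf coaction is also a bimonoid coaction with the same lifting property, so it receives a
unique morphism from `σ`; transposing along the adjunction gives the unique morphism from the
reflected coaction. -/
theorem isInitial_hcoact (hU : IsComodule ρU) (Hl : Bimon C ⥤ Hopf C) (adj : Hl ⊣ hopfToBimon C)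
    (σ : LiftCat (G₂ A) ⟨U, ρU, hU⟩) (hσ : IsInitial σ) :
    ∃ (hco : IsCoaction A ((hopfToBimon C).obj (Hl.obj σ.obj.B))
        (σ.obj.ρ ≫ A.X ◁ (adj.unit.app σ.obj.B).hom.hom))
      (hlift : liftProperty (G₄ A ⋙ G₂ A) ⟨U, ρU, hU⟩ ⟨Hl.obj σ.obj.B, _, hco⟩),
      Nonempty (IsInitial
        (⟨⟨Hl.obj σ.obj.B, _, hco⟩, hlift⟩ : LiftCat (G₄ A ⋙ G₂ A) ⟨U, ρU, hU⟩)) := by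
  have hco : IsCoaction A ((hopfToBimon C).obj (Hl.obj σ.obj.B))
      (σ.obj.ρ ≫ A.X ◁ (adj.unit.app σ.obj.B).hom.hom) := σ.obj.isCoaction.map _
  let z : HCoact A := ⟨Hl.obj σ.obj.B, _, hco⟩
  let m : σ.obj ⟶ (G₄ A).obj z := ⟨adj.unit.app σ.obj.B, rfl⟩
  have hlift : liftProperty (G₄ A ⋙ G₂ A) ⟨U, ρU, hU⟩ z := ⟨σ.property.some ≫ (G₂ A).map m⟩
  refine ⟨hco, hlift, ⟨?_⟩⟩
  have hex (y : HCoact A) (hy : liftProperty (G₄ A ⋙ G₂ A) ⟨U, ρU, hU⟩ y) :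
      Nonempty (z ⟶ y) := by
    let f : σ.obj ⟶ (G₄ A).obj y := (hσ.to (⟨(G₄ A).obj y, hy⟩ : LiftCat (G₂ A) ⟨U, ρU, hU⟩)).hom
    let φ : Hl.obj σ.obj.B ⟶ y.H := (adj.homEquiv _ _).symm f.φ
    have hφ : adj.unit.app σ.obj.B ≫ (hopfToBimon C).map φ = f.φ :=
      (adj.homEquiv_unit _ _ _).symm.trans ((adj.homEquiv _ _).apply_symm_apply f.φ)
    refine ⟨⟨φ, ?_⟩⟩
    change (σ.obj.ρ ≫ A.X ◁ (adj.unit.app σ.obj.B).hom.hom) ≫ _ = _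
    rw [Category.assoc, ← MonoidalCategory.whiskerLeft_comp]
    exact (congrArg (fun x => σ.obj.ρ ≫ A.X ◁ x.hom.hom) hφ).trans f.w
  have huniq (y : HCoact A) (hy : liftProperty (G₄ A ⋙ G₂ A) ⟨U, ρU, hU⟩ y) (f g : z ⟶ y) :
      f = g := by
    have h := hσ.hom_ext (Y := (⟨(G₄ A).obj y, hy⟩ : LiftCat (G₂ A) ⟨U, ρU, hU⟩))
      (ObjectProperty.homMk (m ≫ (G₄ A).map f)) (ObjectProperty.homMk (m ≫ (G₄ A).map g))
    have h' : adj.unit.app σ.obj.B ≫ (hopfToBimon C).map f.φ =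
        adj.unit.app σ.obj.B ≫ (hopfToBimon C).map g.φ := congrArg (fun x => x.hom.φ) h
    exact HCoact.Hom.ext ((adj.homEquiv _ _).injective
      (((adj.homEquiv_unit _ _ _).trans h').trans (adj.homEquiv_unit _ _ _).symm))
  exact IsInitial.ofUniqueHom (fun y => ObjectProperty.homMk (hex y.obj y.property).some)
    fun y m => ObjectProperty.hom_ext _ (huniq _ y.property _ _)

end Coactions
end UnivCoact

theorem mainTheorem5
    {C : Type u} [Category.{v} C] [MonoidalCategory C] [BraidedCategory C]
    [HasLimitsOfSize.{w, w} C]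
    [HasCountableColimits C]
    (h3 : EpiExtrMonoStructured C)
    (h4' : Cowellpowered.{w} C)
    (h5 : TensorPreservesMono C)
    (h5' : TensorPreservesEpi C)
    (h8 : TensorProdComparisonMono.{w} C)
    (h10 : (Mon.forget C).IsRightAdjoint)
    {Ω : Type u'} {s t : Ω → ℕ} (A : OmegaMagma C s t)
    (U : Comon C) (ρU : A.X ⟶ A.X ⊗ U.X) (hU : IsComodule ρU) (hepi : IsTensorEpi ρU) :
    HasInitial (LiftCat (G₄ A ⋙ G₂ A) ⟨U, ρU, hU⟩) ∧
    HasInitial (LiftCat (G₂ A) ⟨U, ρU, hU⟩) ∧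
    (hopfToBimon C).IsRightAdjoint ∧
    ∀ (Hl : Bimon C ⥤ Hopf C) (adj : Hl ⊣ hopfToBimon C)
      (σ : LiftCat (G₂ A) ⟨U, ρU, hU⟩), Nonempty (IsInitial σ) →
      ∃ (hco : IsCoaction A ((hopfToBimon C).obj (Hl.obj σ.obj.B))
          (σ.obj.ρ ≫ A.X ◁ (adj.unit.app σ.obj.B).hom.hom))
        (hlift : liftProperty (G₄ A ⋙ G₂ A) ⟨U, ρU, hU⟩ ⟨Hl.obj σ.obj.B, _, hco⟩),
        Nonempty (IsInitial
          (⟨⟨Hl.obj σ.obj.B, _, hco⟩, hlift⟩ : LiftCat (G₄ A ⋙ G₂ A) ⟨U, ρU, hU⟩)) := by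
  have h₁ := hasInitial_coact_liftCat h3 h4' h5 h5' h8 h10 hU hepi
  have h₂ := hopfToBimon_isRightAdjoint h3 h4' h5' h10
  have h₃ := fun (Hl : Bimon C ⥤ Hopf C) (adj : Hl ⊣ hopfToBimon C)
    (σ : LiftCat (G₂ A) ⟨U, ρU, hU⟩) (hσ : Nonempty (IsInitial σ)) =>
      isInitial_hcoact hU Hl adj σ hσ.some
  refine ⟨?_, h₁, h₂, h₃⟩
  obtain ⟨Hl, ⟨adj⟩⟩ := h₂.exists_leftAdjoint
  obtain ⟨_, _, ⟨h⟩⟩ := h₃ Hl adj (⊥_ _) ⟨initialIsInitial⟩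
  exact h.hasInitial
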